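/- Let $M$ be a smooth (Hausdorff) manifold of dimension $n\ge 2$, let $TM'$ be its tangent bundle without the zero section, $SM=TM'/\mathbb R_{>0}$ the bundle of rays, $\sigma:TM'\to SM$ the quotient map, and let $\mathscr G\subset SM$ be a regular causal geometry: $\mathscr G$ projects onto $M$, and near each of its points the cone $\mathscr H=\sigma^{-1}(\mathscr G)$ is given in a conic open subset of $TM'$ by $G=0$ for a defining function $G$, i.e. a smooth function $G(x,v)$, homogeneous in $v$ of some real degree $\ne 1$, with $\partial G/\partial v\neq 0$ and nondegenerate fibre Hessian $g_{ij}=\partial^2G/\partial v^i\partial v^j$. Fix such a $G$, on a conic open set $U\subset TM'$, and suppose that $g_v=g_{ij}\,dv^i\otimes dv^j$ is Lorentzian (signature $(n-1,1)$ or $(1,n-1)$) on $\mathscr H\cap U$. Put - $V=v^i\partial_{x^i}+u^i\partial_{v^i}$, $u^ig_{ij}=\partial_{x^j}G-v^i\partial_{x^i}\partial_{v^j}G$ (the null geodesic spray; its integral curves in $\mathscr H$ are the affinely parametrized null geodesics); - $P=(dv^i+U^i_j\,dx^j)\otimes\partial_{v^i}$, $U^i_j=-\tfrac12\partial u^i/\partial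 v^j$ (the Ehresmann connection); - $g_h=g_{ij}\,dx^i\otimes dx^j$ and $S=\tfrac12\mathscr L_V^2g_h-g_v(P\cdot,P\cdot)=S_{ij}\,dx^i\otimes dx^j$ (the tidal force tensor), $\operatorname{tr}S^\sharp=g^{ij}S_{ij}$; - $\alpha=(\partial G/\partial v^i)\,dx^i$. A Sachs manifold is a smooth $n$-dimensional submanifold $\mathcal S\subset\mathscr G$ such that the projection $\mathcal S\to M$ is a branched cover (a continuous surjection of Hausdorff spaces that is a local homeomorphism, onto open sets, near each point of a dense set), such that $V$ is tangent to the cone $\sigma^{-1}(\mathcal S)$, and such that $\alpha\wedge d\alpha$ vanishes on the cone $\sigma^{-1}(\mathcal S)$ (these last two conditions being imposed for all defining functions of $\mathscr G$). A smooth section $s:N\to\mathcal S$ over an open set $N\subset M$ determines a congruence of null geodesics of $N$, those whose lifts to $SM$ lie in $s(N)$. If $k$ is a smooth vector field near $x\in N$ that spans the rays $s$ and is affinely parametrized ($k_*k=V$ at $x$, where $k$ is viewed as a map into $TM'$), the divergence of the congruence at $x$ is $\theta(x)=\operatorname{tr}\big(X\mapsto P(k_*X)\big)$, $X\in T_xM$,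 with vertical vectors identified with elements of $T_xM$; its sign does not depend on the choice of $k$. Theorem. Let $X$ be a null geodesic in $M$, with affinely parametrized lift in $\mathscr H\cap U$, that is future complete, i.e. whose affine parameter ranges to $+\infty$. Suppose that the positive energy condition $\operatorname{tr}S^\sharp\le 0$ holds everywhere along (the lift of) $X$, and that there is a smooth section of a Sachs manifold, defined on an open neighbourhood of $X$, such that $X$ is a member of the corresponding congruence. Then the divergence of the congruence is non-negative everywhere along $X$. -/

import Mathlib

open scoped Manifold ContDiff Topology
open Bundle Set

noncomputable section

namespace Causal

/-! ### Local expressions: a Lagrangian `f (x, v)` on an open subset of `E × E` -/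

section Local

variable {E : Type*} [NormedAddCommGroup E] [NormedSpace ℝ E]

/-- The vertical differential `Df`: `w ↦ wⁱ ∂f/∂vⁱ`. -/
def vertD (f : E × E → ℝ) (z : E × E) : E →L[ℝ] ℝ :=
  (fderiv ℝ f z).comp (ContinuousLinearMap.inr ℝ E E)

/-- The fibre Hessian `g_{ij} = ∂²f/∂vⁱ∂vʲ`. -/
def fibreMetric (f : E × E → ℝ) (z : E × E) : E →L[ℝ] E →L[ℝ] ℝ :=
  (fderiv ℝ (vertD f) z).comp (ContinuousLinearMap.inr ℝ E E)

/-- The acceleration `uⁱ` of the null geodesic spray, the solution of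
`uⁱ g_{ij} = ∂f/∂xʲ - vⁱ ∂²f/∂xⁱ∂vʲ`. -/
def accel (f : E × E → ℝ) (z : E × E) : E :=
  (fibreMetric f z).inverse
    ((fderiv ℝ f z).comp (ContinuousLinearMap.inl ℝ E E) - fderiv ℝ (vertD f) z (z.2, 0))

/-- The null geodesic spray `V = vⁱ ∂/∂xⁱ + uⁱ ∂/∂vⁱ`. -/
def localSpray (f : E × E → ℝ) (z : E × E) : E × E := (z.2, accel f z)

/-- The Ehresmann connection `P = (dvⁱ + Uⁱ_j dxʲ) ⊗ ∂/∂vⁱ` with `Uⁱ_j = -½ ∂uⁱ/∂vʲ`; its value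
is recorded through the identification of vertical vectors with tangent vectors of the base. -/
def localConnection (f : E × E → ℝ) (z : E × E) : E × E →L[ℝ] E :=
  ContinuousLinearMap.snd ℝ E E +
    ((-(1 / 2 : ℝ)) • (fderiv ℝ (accel f) z).comp (ContinuousLinearMap.inr ℝ E E)).comp
      (ContinuousLinearMap.fst ℝ E E)

/-- The horizontal form `g_h = g_{ij} dxⁱ ⊗ dxʲ`. -/
def horizMetric (f : E × E → ℝ) (z X Y : E × E) : ℝ := fibreMetric f z X.1 Y.1

/-- The Lie derivative of a covariant 2-tensor field `T` along a vector field `W`, on a vector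
space: `(L_W T)(X, Y) = (∂_W T)(X, Y) + T(∂_X W, Y) + T(X, ∂_Y W)`. -/
def lieD {F : Type*} [NormedAddCommGroup F] [NormedSpace ℝ F] (W : F → F)
    (T : F → F → F → ℝ) (z X Y : F) : ℝ :=
  fderiv ℝ (fun y => T y X Y) z (W z) + T z (fderiv ℝ W z X) Y + T z X (fderiv ℝ W z Y)

/-- The tidal force tensor: `½ (L_V² g_h)(X, Y) = g_v(P X, P Y) + S(X, Y)`. -/
def localTidal (f : E × E → ℝ) (z X Y : E × E) : ℝ :=
  (1 / 2) * lieD (localSpray f) (lieD (localSpray f) (horizMetric f)) z X Y -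
    fibreMetric f z (localConnection f z X) (localConnection f z Y)

/-- The trace `tr S♯ = g^{ij} S_{ij}` of the endomorphism `S♯` with `g(S♯ X, Y) = S(X, Y)`. Here
`S_{ij}` is the value of `S` on the base directions `i` and `j` (`S` vanishes on vertical ones). -/
def localTidalTrace {n : ℕ} (f : EuclideanSpace ℝ (Fin n) × EuclideanSpace ℝ (Fin n) → ℝ)
    (z : EuclideanSpace ℝ (Fin n) × EuclideanSpace ℝ (Fin n)) : ℝ :=
  ((Matrix.of fun i j : Fin n =>
      fibreMetric f z (EuclideanSpace.single i 1) (EuclideanSpace.single j 1))⁻¹ *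
    Matrix.of fun i j : Fin n =>
      localTidal f z (EuclideanSpace.single i 1, 0) (EuclideanSpace.single j 1, 0)).trace

/-- The one-form `α = (∂f/∂vⁱ) dxⁱ`. -/
def localContact (f : E × E → ℝ) (z : E × E) : E × E →L[ℝ] ℝ :=
  (vertD f z).comp (ContinuousLinearMap.fst ℝ E E)

/-- The two-form `dα`. -/
def localContactD (f : E × E → ℝ) (z X Y : E × E) : ℝ :=
  fderiv ℝ (localContact f) z X Y - fderiv ℝ (localContact f) z Y X

/-- A symmetric form of signature `(1, n - 1)` or `(n - 1, 1)`: up to sign, there is a negative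
vector whose orthogonal complement is positive definite. -/
def IsLorentzian (B : E →L[ℝ] E →L[ℝ] ℝ) : Prop :=
  (∃ a, B a a < 0 ∧ ∀ b, B a b = 0 → b ≠ 0 → 0 < B b b) ∨
    (∃ a, 0 < B a a ∧ ∀ b, B a b = 0 → b ≠ 0 → B b b < 0)

end Local

/-! ### The tangent bundle and the bundle of rays -/

/-- The model space `ℝⁿ`. -/
abbrev Eu (n : ℕ) := EuclideanSpace ℝ (Fin n)

variable {n : ℕ} {M : Type*} [TopologicalSpace M] [ChartedSpace (Eu n) M]

variable (n M) in
/-- The total space `TM`. -/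
abbrev TM := TangentBundle (𝓡 n) M

/-- The scaling `(x, v) ↦ (x, t v)`. -/
def scale (t : ℝ) (p : TM n M) : TM n M := ⟨p.proj, t • p.snd⟩

theorem scale_scale (t r : ℝ) (p : TM n M) : scale t (scale r p) = scale (t * r) p :=
  congrArg (TotalSpace.mk p.proj) (smul_smul t r p.snd)

variable [IsManifold (𝓡 n) ∞ M]

variable (n M) in
/-- The slit tangent bundle `TM'`. -/
abbrev SlitTM := {p : TM n M // p.snd ≠ 0}

variable (n M) in
/-- Two nonzero tangent vectors span the same ray. -/
def raySetoid : Setoid (SlitTM n M) where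
  r p q := ∃ t : ℝ, 0 < t ∧ scale t p.1 = q.1
  iseqv :=
    { refl := fun p => ⟨1, one_pos, by simp [scale]⟩
      symm := by
        rintro p q ⟨t, ht, h⟩
        refine ⟨t⁻¹, inv_pos.mpr ht, ?_⟩
        rw [← h, scale_scale, inv_mul_cancel₀ ht.ne']
        simp [scale]
      trans := by
        rintro p q r ⟨t, ht, h⟩ ⟨t', ht', h'⟩
        exact ⟨t' * t, mul_pos ht' ht, by rw [← h', ← h, scale_scale]⟩ }

variable (n M) in
/-- The bundle `SM` of rays (oriented tangent lines), with the quotient topology. -/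
abbrev SM := Quotient (raySetoid n M)

/-- The quotient map `σ : TM' → SM`. -/
def ray (p : SlitTM n M) : SM n M := Quotient.mk (raySetoid n M) p

/-- The projection `SM → M`. -/
def rayProj (r : SM n M) : M :=
  Quotient.lift (s := raySetoid n M) (fun p => p.1.proj)
    (by
    rintro p q ⟨t, -, h⟩
    have h' := congrArg (fun w : TM n M => w.proj) h
    exact h') r

/-- The cone `σ⁻¹(A)` over a set of rays, as a subset of `TM`. -/
def cone (A : Set (SM n M)) : Set (TM n M) := {p | ∃ h : p.snd ≠ 0, ray ⟨p, h⟩ ∈ A}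

/-! ### Local expressions at a point of `TM`

At `p = (x, v)` the chart of `TM` at `p` is the one induced by the chart of `M` at `x`. Through it
the tangent space `T_p(TM)` is `ℝⁿ × ℝⁿ` (base part, fibre part). -/

/-- The function `G`, read in the chart of `TM` at `p`. -/
def inChart (G : TM n M → ℝ) (p : TM n M) : Eu n × Eu n → ℝ :=
  fun z => G ((extChartAt (𝓡 n).tangent p).symm z)

/-- The coordinates of `p`, in the chart at `p`. -/
def coord (p : TM n M) : Eu n × Eu n := extChartAt (𝓡 n).tangent p p

/-- The fibre metric `g_v` of `G` at `p`. -/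
def metricAt (G : TM n M → ℝ) (p : TM n M) : Eu n →L[ℝ] Eu n →L[ℝ] ℝ :=
  fibreMetric (inChart G p) (coord p)

/-- The null geodesic spray `V` of `G`, a vector field on `TM`. -/
def spray (G : TM n M → ℝ) (p : TM n M) : TangentSpace (𝓡 n).tangent p :=
  (localSpray (inChart G p) (coord p) : Eu n × Eu n)

/-- The Ehresmann connection of `G`, followed by the identification of the vertical space at
`p = (x, v)` with `T_x M`. -/
def connection (G : TM n M → ℝ) (p : TM n M) :
    TangentSpace (𝓡 n).tangent p →L[ℝ] TangentSpace (𝓡 n) p.proj :=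
  (localConnection (inChart G p) (coord p) : Eu n × Eu n →L[ℝ] Eu n)

/-- The function `tr S♯` on `TM`. -/
def tidalTrace (G : TM n M → ℝ) (p : TM n M) : ℝ :=
  localTidalTrace (inChart G p) (coord p)

/-- The contact form `α` of `G`. -/
def contactForm (G : TM n M → ℝ) (p : TM n M) (X : TangentSpace (𝓡 n).tangent p) : ℝ :=
  localContact (inChart G p) (coord p) X

/-- The two-form `dα` of `G`. -/
def contactFormD (G : TM n M → ℝ) (p : TM n M) (X Y : TangentSpace (𝓡 n).tangent p) : ℝ :=
  localContactD (inChart G p) (coord p) X Y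

/-! ### Causal geometries -/

/-- A (regular) homogeneous defining function, on a conic open set, of the cone over a set of rays:
`G` is smooth and homogeneous of a degree `k ≠ 1`, the cone is its zero set, `DG ≠ 0`, and the
fibre Hessian is nondegenerate. -/
structure DefiningFunction (𝒢 : Set (SM n M)) where
  G : TM n M → ℝ
  domain : Set (TM n M)
  degree : ℝ
  isOpen_domain : IsOpen domain
  ne_zero : ∀ p ∈ domain, p.snd ≠ 0
  scale_mem : ∀ p ∈ domain, ∀ t : ℝ, 0 < t → scale t p ∈ domain
  smooth : ContMDiffOn (𝓡 n).tangent 𝓘(ℝ, ℝ) ∞ G domain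
  degree_ne_one : degree ≠ 1
  homogeneous : ∀ p ∈ domain, ∀ t : ℝ, 0 < t → G (scale t p) = t ^ degree * G p
  zero_iff : ∀ p ∈ domain, G p = 0 ↔ p ∈ cone 𝒢
  vertD_ne_zero : ∀ p ∈ domain, vertD (inChart G p) (coord p) ≠ 0
  nondegenerate : ∀ p ∈ domain, ∀ a, (∀ b, metricAt G p a b = 0) → a = 0

/-- A regular causal geometry on `M`: a set of rays that meets every fibre of `SM` and has a regular
defining function near each of its points. -/
structure IsRegularCausalGeometry (𝒢 : Set (SM n M)) : Prop where
  surj : ∀ x : M, ∃ r ∈ 𝒢, rayProj r = x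
  exists_definingFunction : ∀ p ∈ cone 𝒢, ∃ L : DefiningFunction 𝒢, p ∈ L.domain

/-- An affinely parametrized null geodesic (lifted to the cone) whose affine parameter ranges over
`J`, an open interval that is unbounded above. -/
structure IsFutureCompleteNullGeodesic {𝒢 : Set (SM n M)} (L : DefiningFunction 𝒢) (J : Set ℝ)
    (c : ℝ → TM n M) : Prop where
  isOpen : IsOpen J
  isUpperSet : IsUpperSet J
  nonempty : J.Nonempty
  mem_cone : ∀ t ∈ J, c t ∈ cone 𝒢
  mem_domain : ∀ t ∈ J, c t ∈ L.domain
  isIntegralCurve : IsMIntegralCurveOn c (spray L.G) J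

/-! ### Branched covers, submanifolds, Sachs manifolds -/

/-- `y` has an open neighbourhood that `f` maps homeomorphically onto an open set. -/
def IsSheafPoint {Y X : Type*} [TopologicalSpace Y] [TopologicalSpace X] (f : Y → X) (y : Y) :
    Prop :=
  ∃ U : Set Y, IsOpen U ∧ y ∈ U ∧ Topology.IsOpenEmbedding (U.domRestrict f)

/-- A branched cover: Hausdorff spaces, a continuous surjection, a dense set of sheaf points. -/
structure IsBranchedCover {Y X : Type*} [TopologicalSpace Y] [TopologicalSpace X] (f : Y → X) :
    Prop where
  continuous : Continuous f
  surjective : Function.Surjective f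
  dense : Dense {y | IsSheafPoint f y}
  t2_source : T2Space Y
  t2_target : T2Space X

/-- `A` is an embedded smooth submanifold of `TM` of codimension `m`. -/
def IsSubmanifold (A : Set (TM n M)) (m : ℕ) : Prop :=
  ∀ p ∈ A, ∃ (W : Set (TM n M)) (F : TM n M → Eu m), IsOpen W ∧ p ∈ W ∧
    ContMDiffOn (𝓡 n).tangent 𝓘(ℝ, Eu m) ∞ F W ∧
    (∀ q ∈ W, Function.Surjective (mfderiv (𝓡 n).tangent 𝓘(ℝ, Eu m) F q)) ∧
    ∀ q ∈ W, q ∈ A ↔ F q = 0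

/-- `X` is tangent at `p` to the submanifold `A`: it annihilates all smooth functions that vanish
on `A` near `p`. -/
def IsTangentTo (A : Set (TM n M)) (p : TM n M) (X : TangentSpace (𝓡 n).tangent p) : Prop :=
  ∀ f : TM n M → ℝ, ContMDiffAt (𝓡 n).tangent 𝓘(ℝ, ℝ) ∞ f p → (∀ᶠ q in 𝓝 p, q ∈ A → f q = 0) →
    mfderiv (𝓡 n).tangent 𝓘(ℝ, ℝ) f p X = 0

/-- A Sachs manifold of the causal geometry `𝒢`: a smooth `n`-dimensional submanifold `𝒮` of `SM`
inside `𝒢` (equivalently, its cone is an `(n + 1)`-dimensional submanifold of the `2n`-dimensional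
`TM`), a branched cover of `M`, ruled by null geodesics, and hypersurface orthogonal: `α ∧ dα`
vanishes on it. The last two conditions are expressed on the cone by means of defining functions
(they do not depend on the choice of these, and hold along the scaling directions). -/
structure IsSachsManifold (𝒢 𝒮 : Set (SM n M)) : Prop where
  subset : 𝒮 ⊆ 𝒢
  isSubmanifold : IsSubmanifold (cone 𝒮) (n - 1)
  isBranchedCover : IsBranchedCover (fun r : 𝒮 => rayProj r.1)
  ruled : ∀ (L : DefiningFunction 𝒢), ∀ p ∈ L.domain, p ∈ cone 𝒮 →
    IsTangentTo (cone 𝒮) p (spray L.G p)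
  hypersurfaceOrthogonal : ∀ (L : DefiningFunction 𝒢), ∀ p ∈ L.domain, p ∈ cone 𝒮 →
    ∀ X Y Z : TangentSpace (𝓡 n).tangent p,
      IsTangentTo (cone 𝒮) p X → IsTangentTo (cone 𝒮) p Y → IsTangentTo (cone 𝒮) p Z →
      contactForm L.G p X * contactFormD L.G p Y Z + contactForm L.G p Y * contactFormD L.G p Z X +
        contactForm L.G p Z * contactFormD L.G p X Y = 0

/-- The section `x ↦ (x, k x)` of `TM` defined by a vector field `k`. -/
def graph (k : ∀ x : M, TangentSpace (𝓡 n) x) (x : M) : TM n M := ⟨x, k x⟩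

/-- `k` is a smooth vector field on the open set `W` that spans the rays `s x`, `x ∈ W`. -/
structure IsRepresentative (s : M → SM n M) (W : Set M) (k : ∀ x : M, TangentSpace (𝓡 n) x) :
    Prop where
  isOpen : IsOpen W
  smooth : ContMDiffOn (𝓡 n) (𝓡 n).tangent ∞ (graph k) W
  spans : ∀ x ∈ W, ∃ h : k x ≠ 0, ray ⟨graph k x, h⟩ = s x

/-- `s` is a smooth section over the open set `N` of the set of rays `𝒮`. -/
structure IsSmoothSection (𝒮 : Set (SM n M)) (N : Set M) (s : M → SM n M) : Prop where
  isOpen : IsOpen N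
  mem : ∀ x ∈ N, s x ∈ 𝒮
  proj : ∀ x ∈ N, rayProj (s x) = x
  smooth : ∀ x ∈ N, ∃ (W : Set M) (k : ∀ x : M, TangentSpace (𝓡 n) x), x ∈ W ∧
    IsRepresentative s W k

/-- The push-forward `s_* : T_x M → T_{(x, k x)}(TM)` by the section defined by `k`. -/
def pushforward (k : ∀ x : M, TangentSpace (𝓡 n) x) (x : M) :
    TangentSpace (𝓡 n) x →L[ℝ] TangentSpace (𝓡 n).tangent (graph k x) :=
  mfderiv (𝓡 n) (𝓡 n).tangent (graph k) x

/-- The endomorphism `P_s` of `T_x M`: push forward by the section, then apply the connection. -/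
def sectionEnd (G : TM n M → ℝ) (k : ∀ x : M, TangentSpace (𝓡 n) x) (x : M) :
    TangentSpace (𝓡 n) x →L[ℝ] TangentSpace (𝓡 n) x :=
  (connection G (graph k x)).comp (pushforward k x)

/-- The divergence `θ = tr P_s` at `x`. -/
def divergence (G : TM n M → ℝ) (k : ∀ x : M, TangentSpace (𝓡 n) x) (x : M) : ℝ :=
  LinearMap.trace ℝ (TangentSpace (𝓡 n) x) (sectionEnd G k x).toLinearMap

end Causal

end

/-! Raychaudhuri's equation forces the divergence to satisfy a Riccati inequality, and a negative
solution of that inequality reaches -∞ in finite affine time.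

Represent the congruence locally by a field `κ`, with `B X = P(κ_* X)` (`fieldEnd`). Since `κ` need
not be affinely parametrized, there is a factor `r` with `u - Dκ κ = r κ`. The quantity carried
through the proof is the expansion `tr B + r`: it is independent of coordinates and is multiplied by
`s` when `κ` is replaced by `s κ` (`HasExpansion.transport`, `expansion_change`). Dividing it by the
factor relating `κ` to the velocity of the geodesic gives a single function `θ` along the whole
curve, although fields are used only locally. For an affinely parametrized field `r = 0`, and the
expansion is the divergence.

The factor `r` exists by a dimension count (`exists_hasExpansion`): the tangent space of the cone
over the Sachs manifold is spanned by the push-forwards `κ_* X` and the radial vertical vector, and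
the spray lies in it. Differentiating the geodesic equation and taking traces gives `θ' = tr S♯ -
(tr B² - r²)` (`IsRegularOn.raychaudhuri`, `IsRegularOn.riccati`).

The last term is bounded on the screen space `κ^⊥/κ`. The map `B` has eigenvalue `-r` on `κ`, and
its image lies in `κ^⊥` because the congruence is null, so `tr B + r` and `tr B² - r²` are the
traces of the map induced on the screen and of its square. Hypersurface orthogonality makes this
induced map symmetric for the metric, which is definite there; Cauchy–Schwarz then gives `θ² ≤ n (tr
B² - r²)` (`sq_screenTrace_le`, `IsRegularOn.sq_expansion_le`). With the energy condition, `θ² ≤ -n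
θ'`, and `nonneg_of_riccati` concludes on a half-line. -/

noncomputable section

namespace Causal

/-! ### Trace inequalities on the screen space of a null vector -/

section LinearAlgebra

variable {E : Type*} [NormedAddCommGroup E] [NormedSpace ℝ E]

/-- An endomorphism that is symmetric for a positive definite form satisfies
`(tr C)² ≤ dim · tr C²`. -/
theorem sq_trace_le_of_symmetric [FiniteDimensional ℝ E] (h : LinearMap.BilinForm ℝ E)
    (hs : ∀ X Y, h X Y = h Y X) (hpos : ∀ X, X ≠ 0 → 0 < h X X) (C : E →ₗ[ℝ] E) (hC : ∀ X Y, h (C X) Y = h X (C Y)) :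
    (LinearMap.trace ℝ E C) ^ 2 ≤ Module.finrank ℝ E * LinearMap.trace ℝ E (C ∘ₗ C) := by
  obtain ⟨v, hv⟩ := LinearMap.BilinForm.exists_orthogonal_basis (B := h) ⟨hs⟩
  have hvp : ∀ i, 0 < h (v i) (v i) := fun i => hpos _ (v.ne_zero i)
  have horth : ∀ i j, i ≠ j → h (v i) (v j) = 0 := fun i j hij => hv hij
  have hcoord : ∀ (X : E) i, h (v i) X = v.repr X i * h (v i) (v i) := by
    intro X i
    conv_lhs => rw [← v.sum_repr X]
    rw [map_sum, Finset.sum_eq_single i]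
    · simp
    · intro j _ hj
      simp [horth i j hj.symm]
    · simp
  set A : Matrix _ _ ℝ := LinearMap.toMatrix v v C with hA
  have hAij : ∀ i j, A i j * h (v i) (v i) = A j i * h (v j) (v j) := by
    intro i j
    rw [hA, LinearMap.toMatrix_apply, LinearMap.toMatrix_apply, ← hcoord, ← hcoord, ← hC, hs]
  rw [LinearMap.trace_eq_matrix_trace ℝ v, LinearMap.trace_eq_matrix_trace ℝ v,
    LinearMap.toMatrix_comp v v v, ← hA]
  -- In an orthogonal basis symmetry relates `A i j` and `A j i` by a positive factor, so the
  -- off-diagonal terms of `tr A²` can be discarded, leaving Cauchy–Schwarz on the diagonal.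
  have hterm : ∀ i j, 0 ≤ A i j * A j i := by
    intro i j
    have : A i j * A j i * h (v i) (v i) = A j i ^ 2 * h (v j) (v j) := by
      linear_combination A j i * hAij i j
    have h2 : 0 ≤ A i j * A j i * h (v i) (v i) := this ▸ mul_nonneg (sq_nonneg _) (hvp j).le
    exact nonneg_of_mul_nonneg_left h2 (hvp i)
  calc (A.trace) ^ 2 ≤ (Finset.univ : Finset (Fin (Module.finrank ℝ E))).card *
        ∑ i, A i i ^ 2 := sq_sum_le_card_mul_sum_sq
    _ ≤ Module.finrank ℝ E * (A * A).trace := by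
      rw [Finset.card_univ, Fintype.card_fin]
      gcongr
      unfold Matrix.trace
      refine Finset.sum_le_sum fun i _ => ?_
      rw [Matrix.diag_apply, Matrix.mul_apply, sq]
      exact Finset.single_le_sum (f := fun j => A i j * A j i) (fun j _ => hterm i j)
        (Finset.mem_univ i)

/-- If `v` is null for a Lorentzian form, the form is definite on complements of `v` in its
orthogonal space. -/
theorem exists_screen (g : E →L[ℝ] E →L[ℝ] ℝ) (hs : ∀ a b, g a b = g b a) (hL : IsLorentzian g)
    {v : E} (hv : v ≠ 0) (hnull : g v v = 0) :
    ∃ (ε : ℝ) (l : E), g l v = 1 ∧ g l l = 0 ∧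
      ∀ X, g X v = 0 → g X l = 0 → X ≠ 0 → 0 < ε * g X X := by
  have key : ∀ (ε : ℝ) (a : E), (∀ b, g a b = 0 → b ≠ 0 → 0 < ε * g b b) →
      ∃ (l : E), g l v = 1 ∧ g l l = 0 ∧
      ∀ X, g X v = 0 → g X l = 0 → X ≠ 0 → 0 < ε * g X X := by
    intro ε a ha
    have hav : g a v ≠ 0 := by
      intro h0
      have := ha v h0 hv
      simp [hnull] at this
    -- Rescale `a` to pair to 1 with `v`, then subtract the multiple of `v` that makes the result
    -- null.
    refine ⟨(g a v)⁻¹ • a - ((g a v)⁻¹ ^ 2 * g a a / 2) • v, ?_, ?_, ?_⟩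
    · simp [hnull, hav]
    · simp [hnull, hs v a]
      field_simp
      ring
    · intro X hXv hXl hX
      -- A correction along `v` brings `X` into the orthogonal space of `a` without changing its
      -- square.
      set Y : E := X - (g a X / g a v) • v with hY
      have hYa : g a Y = 0 := by simp [hY, hav]
      have hYY : g Y Y = g X X := by simp [hY, hnull, hXv, hs v X]
      rw [← hYY]
      refine ha Y hYa fun hY0 => hX ?_
      have hXe : X = (g a X / g a v) • v := sub_eq_zero.mp hY0
      have hgX : g X a = 0 := by
        simp [hXv, hav] at hXl
        exact hXl
      rw [hXe, hs a X, hgX]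
      simp
  rcases hL with ⟨a, -, ha⟩ | ⟨a, -, ha⟩
  · exact ⟨1, key 1 a fun b hb hb0 => by simpa using ha b hb hb0⟩
  · exact ⟨-1, key (-1) a fun b hb hb0 => by simpa using ha b hb hb0⟩

/-- The trace inequality behind the Riccati comparison: `B` maps into the orthogonal space of the
null vector `v`, has `v` as eigenvector, and is symmetric on the orthogonal space. -/
theorem sq_screenTrace_le [FiniteDimensional ℝ E] (g : E →L[ℝ] E →L[ℝ] ℝ) (hs : ∀ a b, g a b = g b a)
    (hL : IsLorentzian g) {v : E} (hv : v ≠ 0) (hnull : g v v = 0) (B : E →ₗ[ℝ] E) (r : ℝ)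
    (hBv : B v = -r • v) (hBperp : ∀ X, g (B X) v = 0)
    (hBs : ∀ X Y, g X v = 0 → g Y v = 0 → g (B X) Y = g X (B Y)) :
    (LinearMap.trace ℝ E B + r) ^ 2 ≤
      Module.finrank ℝ E * (LinearMap.trace ℝ E (B ∘ₗ B) - r ^ 2) := by
  obtain ⟨ε, l, hlv, hll, hpos⟩ := exists_screen g hs hL hv hnull
  have hvl : g v l = 1 := by rw [hs, hlv]
  let gv : E →ₗ[ℝ] ℝ := (g v : E →ₗ[ℝ] ℝ)
  let gl : E →ₗ[ℝ] ℝ := (g l : E →ₗ[ℝ] ℝ)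
  -- The orthogonal projector that kills the plane of `v` and `l`; its image is a concrete model of
  -- the screen `v^⊥/v`.
  let S : E →ₗ[ℝ] E := LinearMap.id - gv.smulRight l - gl.smulRight v
  have hS : ∀ X, S X = X - g v X • l - g l X • v := fun X => rfl
  have hSv : ∀ X, g (S X) v = 0 := by intro X; simp [hS, hlv, hnull, hs X v]
  have hSl : ∀ X, g (S X) l = 0 := by intro X; simp [hS, hvl, hll, hs X l]
  have hSS : ∀ X, S (S X) = S X := by
    intro X
    rw [hS (S X), hs v, hs l, hSv, hSl]; simp
  have hSid : S ∘ₗ S = S := LinearMap.ext hSS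
  have hSs : ∀ X Y, g (S X) Y = g X (S Y) := by
    intro X Y; simp [hS, hs X v, hs X l]; ring
  let C : E →ₗ[ℝ] E := S ∘ₗ B ∘ₗ S
  -- The definite form of the screen, completed by squares in the two remaining directions to a
  -- positive form on all of `E`. This avoids a quotient space, at the price of the dimension of `E`
  -- in the bound instead of that of the screen.
  let h : LinearMap.BilinForm ℝ E :=
    LinearMap.mk₂ ℝ (fun X Y => ε * g (S X) (S Y) + g v X * g v Y + g l X * g l Y)
      (by intros; simp; ring) (by intros; simp; ring) (by intros; simp; ring)
      (by intros; simp; ring)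
  have hh : ∀ X Y, h X Y = ε * g (S X) (S Y) + g v X * g v Y + g l X * g l Y := fun X Y => rfl
  have hCp : ∀ X, g v (C X) = 0 ∧ g l (C X) = 0 := fun X =>
    ⟨by rw [hs]; exact hSv _, by rw [hs]; exact hSl _⟩
  have hineq := sq_trace_le_of_symmetric h
    (by intro X Y; rw [hh, hh, hs (S X)]; ring)
    (by
      intro X hX
      rw [hh]
      by_cases hX0 : S X = 0
      · have h1 : g v X ≠ 0 ∨ g l X ≠ 0 := by
          by_contra! hcon
          apply hX
          have := hS X
          rw [hX0, hcon.1, hcon.2] at this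
          simpa using this.symm
        rw [hX0]
        rcases h1 with h1 | h1
        · have := mul_self_pos.mpr h1
          have := mul_self_nonneg (g l X)
          simp; linarith
        · have := mul_self_pos.mpr h1
          have := mul_self_nonneg (g v X)
          simp; linarith
      · have := hpos (S X) (hSv X) (hSl X) hX0
        have := mul_self_nonneg (g l X)
        have := mul_self_nonneg (g v X)
        linarith) C
    (by
      intro X Y
      rw [hh, hh, (hCp X).1, (hCp X).2, (hCp Y).1, (hCp Y).2]
      have e1 : S (C X) = S (B (S X)) := hSS _
      have e2 : S (C Y) = S (B (S Y)) := hSS _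
      have e3 : g (S (B (S X))) (S Y) = g (B (S X)) (S Y) := by rw [hSs, hSS]
      have e4 : g (S X) (S (B (S Y))) = g (S X) (B (S Y)) := by rw [← hSs, hSS]
      rw [e1, e2, e3, e4, hBs _ _ (hSv X) (hSv Y)]
      ring)
  have hSB : ∀ X, S (B X) = B X - g l (B X) • v := by
    intro X; rw [hS, hs v, hBperp]; simp
  -- Outside the screen, `B` contributes `-r` from its eigenvector `v` and nothing from `E/v^⊥`,
  -- since its image lies in `v^⊥`.
  have htr1 : LinearMap.trace ℝ E C = LinearMap.trace ℝ E B + r := by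
    have e1 : LinearMap.trace ℝ E C = LinearMap.trace ℝ E (S ∘ₗ B) := by
      change LinearMap.trace ℝ E (S ∘ₗ (B ∘ₗ S)) = _
      rw [LinearMap.trace_comp_comm', LinearMap.comp_assoc, hSid, LinearMap.trace_comp_comm']
    have e2 : S ∘ₗ B = B - (gl ∘ₗ B).smulRight v := LinearMap.ext hSB
    rw [e1, e2, map_sub, LinearMap.trace_smulRight]
    change _ - g l (B v) = _
    rw [hBv]; simp [hlv]
  have htr2 : LinearMap.trace ℝ E (C ∘ₗ C) = LinearMap.trace ℝ E (B ∘ₗ B) - r ^ 2 := by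
    have e1 : LinearMap.trace ℝ E (C ∘ₗ C) = LinearMap.trace ℝ E ((S ∘ₗ B) ∘ₗ (S ∘ₗ B)) := by
      have : C ∘ₗ C = (S ∘ₗ B ∘ₗ S ∘ₗ B) ∘ₗ S := by
        ext X
        change S (B (S (S (B (S X))))) = S (B (S (B (S X))))
        rw [hSS]
      rw [this, LinearMap.trace_comp_comm', ← LinearMap.comp_assoc, hSid]
      rfl
    have e2 : (S ∘ₗ B) ∘ₗ (S ∘ₗ B) = B ∘ₗ B - (gl ∘ₗ B ∘ₗ B).smulRight v := by
      ext X
      change S (B (S (B X))) = B (B X) - g l (B (B X)) • v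
      rw [hSB, hSB, map_sub, map_smul, hBv]
      simp only [map_sub, map_smul, smul_eq_mul, hlv, map_neg, neg_smul, smul_neg, sub_smul]
      module
    rw [e1, e2, map_sub, LinearMap.trace_smulRight]
    change _ - g l (B (B v)) = _
    rw [hBv]; simp [hlv, hBv]; ring
  rw [htr1, htr2] at hineq
  exact hineq

end LinearAlgebra

/-! ### Calculus of a homogeneous Lagrangian and of its spray -/

section Lagrangian

variable {E : Type*} [NormedAddCommGroup E] [NormedSpace ℝ E]

/-- A smooth function on an open set of `E × E`, with nondegenerate fibre Hessian, that satisfies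
Euler's relation of degree `d` along the fibres. -/
structure IsRegularOn (f : E × E → ℝ) (d : ℝ) (Ω : Set (E × E)) : Prop where
  isOpen : IsOpen Ω
  smooth : ContDiffOn ℝ ∞ f Ω
  invertible : ∀ z ∈ Ω, (fibreMetric f z).IsInvertible
  euler : ∀ z ∈ Ω, vertD f z z.2 = d * f z

/-- The vertical derivative of the spray acceleration. -/
def accelV (f : E × E → ℝ) (z : E × E) : E →L[ℝ] E :=
  (fderiv ℝ (accel f) z).comp (ContinuousLinearMap.inr ℝ E E)

/-- The tidal endomorphism `∂u/∂x + V(U) + U²`. -/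
def tidalEnd (f : E × E → ℝ) (z : E × E) : E →L[ℝ] E :=
  (fderiv ℝ (accel f) z).comp (ContinuousLinearMap.inl ℝ E E) +
    (-(1 / 2 : ℝ)) • (fderiv ℝ (fderiv ℝ (accel f)) z (localSpray f z)).comp
      (ContinuousLinearMap.inr ℝ E E) +
    ((-(1 / 2 : ℝ)) • accelV f z).comp ((-(1 / 2 : ℝ)) • accelV f z)

theorem fderiv_symm_of_contDiffAt {F : Type*} [NormedAddCommGroup F] [NormedSpace ℝ F]
    {F' : Type*} [NormedAddCommGroup F'] [NormedSpace ℝ F'] {h : F → F'} {z : F}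
    (hh : ContDiffAt ℝ ∞ h z) (a b : F) :
    fderiv ℝ (fderiv ℝ h) z a b = fderiv ℝ (fderiv ℝ h) z b a :=
  (hh.isSymmSndFDerivAt (by
    rw [minSmoothness_of_isRCLikeNormedField]; exact ENat.LEInfty.out)) a b

theorem contDiffAt_fderiv_of {F : Type*} [NormedAddCommGroup F] [NormedSpace ℝ F]
    {F' : Type*} [NormedAddCommGroup F'] [NormedSpace ℝ F'] {h : F → F'} {z : F}
    (hh : ContDiffAt ℝ ∞ h z) : ContDiffAt ℝ ∞ (fderiv ℝ h) z :=
  hh.fderiv_right (by simp)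

theorem fderiv_clm_comp_const {F G : Type*} [NormedAddCommGroup F] [NormedSpace ℝ F]
    [NormedAddCommGroup G] [NormedSpace ℝ G] {F' : Type*} [NormedAddCommGroup F']
    [NormedSpace ℝ F'] {h : F → G →L[ℝ] F'} {z : F} {H : Type*} [NormedAddCommGroup H]
    [NormedSpace ℝ H] (A : H →L[ℝ] G)
    (hh : DifferentiableAt ℝ h z) (ζ : F) :
    fderiv ℝ (fun y => (h y).comp A) z ζ = (fderiv ℝ h z ζ).comp A := by
  have := hh.hasFDerivAt.clm_comp (hasFDerivAt_const A z)
  rw [this.fderiv]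
  ext; simp

theorem fderiv_clm_apply_const {F G : Type*} [NormedAddCommGroup F] [NormedSpace ℝ F]
    [NormedAddCommGroup G] [NormedSpace ℝ G] {F' : Type*} [NormedAddCommGroup F']
    [NormedSpace ℝ F'] {h : F → G →L[ℝ] F'} {z : F} (a : G)
    (hh : DifferentiableAt ℝ h z) (ζ : F) :
    fderiv ℝ (fun y => h y a) z ζ = fderiv ℝ h z ζ a := by
  have := hh.hasFDerivAt.clm_apply (hasFDerivAt_const a z)
  rw [this.fderiv]
  simp

section smooth
variable {f : E × E → ℝ} {z : E × E} (hf : ContDiffAt ℝ ∞ f z)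
include hf

theorem contDiffAt_vertD : ContDiffAt ℝ ∞ (vertD f) z :=
  (contDiffAt_fderiv_of hf).clm_comp contDiffAt_const

theorem contDiffAt_fibreMetric : ContDiffAt ℝ ∞ (fibreMetric f) z :=
  (contDiffAt_fderiv_of (contDiffAt_vertD hf)).clm_comp contDiffAt_const

theorem fderiv_vertD_apply (ζ : E × E) (w : E) :
    fderiv ℝ (vertD f) z ζ w = fderiv ℝ (fderiv ℝ f) z ζ (0, w) := by
  have := fderiv_clm_comp_const (ContinuousLinearMap.inr ℝ E E)
    ((contDiffAt_fderiv_of hf).differentiableAt (by simp)) ζ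
  have h2 : fderiv ℝ (vertD f) z ζ =
      (fderiv ℝ (fderiv ℝ f) z ζ).comp (ContinuousLinearMap.inr ℝ E E) := this
  rw [h2]; simp

theorem fibreMetric_symm (a b : E) : fibreMetric f z a b = fibreMetric f z b a := by
  change fderiv ℝ (vertD f) z (0, a) b = fderiv ℝ (vertD f) z (0, b) a
  rw [fderiv_vertD_apply hf, fderiv_vertD_apply hf, fderiv_symm_of_contDiffAt hf]

theorem fderiv_fderiv_vert_horiz (b w : E) :
    fderiv ℝ (fun y => fderiv ℝ f y (w, 0)) z (0, b) = fderiv ℝ (vertD f) z (w, 0) b := by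
  rw [fderiv_clm_apply_const _ ((contDiffAt_fderiv_of hf).differentiableAt (by simp)),
    fderiv_vertD_apply hf, fderiv_symm_of_contDiffAt hf]

end smooth

section complete
variable [CompleteSpace E]

theorem contDiffAt_accel {f : E × E → ℝ} {z : E × E} (hf : ContDiffAt ℝ ∞ f z)
    (hinv : (fibreMetric f z).IsInvertible) : ContDiffAt ℝ ∞ (accel f) z := by
  obtain ⟨e, he⟩ := hinv
  have h1 : ContDiffAt ℝ ∞ (fun y => (fibreMetric f y).inverse) z := by
    have := contDiffAt_map_inverse (𝕜 := ℝ) (n := ∞) e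
    rw [he] at this
    exact this.comp z (contDiffAt_fibreMetric hf)
  have h2 : ContDiffAt ℝ ∞ (fun y : E × E => fderiv ℝ (vertD f) y (y.2, 0)) z :=
    (contDiffAt_fderiv_of (contDiffAt_vertD hf)).clm_apply
      (contDiffAt_snd.prodMk contDiffAt_const)
  exact h1.clm_apply
    (((contDiffAt_fderiv_of hf).clm_comp contDiffAt_const).sub h2)

end complete

/-- The Euler–Lagrange equation determines the acceleration. -/
theorem eulerLagrange_iff {f : E × E → ℝ} {z : E × E}
    (hinv : (fibreMetric f z).IsInvertible) (u : E) :
    (∀ w, fderiv ℝ (vertD f) z (z.2, u) w = fderiv ℝ f z (w, 0)) ↔ u = accel f z := by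
  obtain ⟨e, he⟩ := hinv
  have hsplit : ∀ u w, fderiv ℝ (vertD f) z (z.2, u) w =
      fderiv ℝ (vertD f) z (z.2, 0) w + fibreMetric f z u w := by
    intro u w
    have : ((z.2, u) : E × E) = (z.2, 0) + (0, u) := by simp
    rw [this, map_add]
    rfl
  have haccel : fibreMetric f z (accel f z) =
      ((fderiv ℝ f z).comp (ContinuousLinearMap.inl ℝ E E) -
        fderiv ℝ (vertD f) z (z.2, 0)) := by
    unfold accel
    rw [← he, ContinuousLinearMap.inverse_equiv]
    exact e.apply_symm_apply _
  have hacc : ∀ w, fderiv ℝ (vertD f) z (z.2, accel f z) w = fderiv ℝ f z (w, 0) := by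
    intro w
    rw [hsplit, haccel]; simp
  constructor
  · intro h
    have : fibreMetric f z u = fibreMetric f z (accel f z) := by
      ext w
      have h1 := h w
      rw [← hacc w, hsplit u, hsplit (accel f z)] at h1
      linarith
    rw [← he] at this
    exact e.injective this
  · rintro rfl; exact hacc

namespace IsRegularOn

variable {f : E × E → ℝ} {d : ℝ} {Ω : Set (E × E)} (h : IsRegularOn f d Ω)
  {z : E × E} (hz : z ∈ Ω)
include h hz

theorem mem_nhds : Ω ∈ 𝓝 z := h.isOpen.mem_nhds hz

theorem contDiffAt : ContDiffAt ℝ ∞ f z := h.smooth.contDiffAt (h.mem_nhds hz)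

theorem accel_contDiffAt [CompleteSpace E] : ContDiffAt ℝ ∞ (accel f) z :=
  contDiffAt_accel (h.contDiffAt hz) (h.invertible z hz)

theorem eulerLagrange (w : E) :
    fderiv ℝ (vertD f) z (localSpray f z) w = fderiv ℝ f z (w, 0) :=
  (eulerLagrange_iff (h.invertible z hz) _).2 rfl w

theorem fibreMetric_eq_zero {a : E} (ha : ∀ b, fibreMetric f z a b = 0) : a = 0 := by
  obtain ⟨e, he⟩ := h.invertible z hz
  apply e.injective
  rw [map_zero]
  ext b
  have := ha b
  rw [← he] at this
  exact this

theorem fderiv_fibreMetric_apply (ζ : E × E) (b w : E) :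
    fderiv ℝ (fibreMetric f) z ζ b w = fderiv ℝ (fderiv ℝ (vertD f)) z ζ (0, b) w := by
  have := fderiv_clm_comp_const (ContinuousLinearMap.inr ℝ E E)
    ((contDiffAt_fderiv_of (contDiffAt_vertD (h.contDiffAt hz))).differentiableAt (by simp)) ζ
  have h2 : fderiv ℝ (fibreMetric f) z ζ =
      (fderiv ℝ (fderiv ℝ (vertD f)) z ζ).comp (ContinuousLinearMap.inr ℝ E E) := this
  rw [h2]; simp

theorem fderiv_fibreMetric_symm (ζ : E × E) (b w : E) :
    fderiv ℝ (fibreMetric f) z ζ b w = fderiv ℝ (fibreMetric f) z ζ w b := by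
  have hd := (contDiffAt_fibreMetric (h.contDiffAt hz)).differentiableAt (by simp)
  have e : ∀ b w, fderiv ℝ (fun y => fibreMetric f y b w) z ζ =
      fderiv ℝ (fibreMetric f) z ζ b w := by
    intro b w
    rw [fderiv_clm_apply_const w (hd.clm_apply (differentiableAt_const b)),
      fderiv_clm_apply_const b hd]
  rw [← e, ← e]
  have : (fun y => fibreMetric f y b w) =ᶠ[𝓝 z] fun y => fibreMetric f y w b := by
    filter_upwards [h.mem_nhds hz] with y hy
    exact fibreMetric_symm (h.contDiffAt hy) b w
  rw [this.fderiv_eq]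

/-- Euler's relation differentiated in an arbitrary direction; its vertical and horizontal cases are
the next two results. -/
theorem fderiv_euler (ζ : E × E) :
    fderiv ℝ (vertD f) z ζ z.2 + vertD f z ζ.2 = d * fderiv ℝ f z ζ := by
  have hq := (contDiffAt_vertD (h.contDiffAt hz)).differentiableAt (by simp)
  have hf := (h.contDiffAt hz).differentiableAt (by simp)
  have heq : (fun y : E × E => vertD f y y.2) =ᶠ[𝓝 z] fun y => d * f y := by
    filter_upwards [h.mem_nhds hz] with y hy
    exact h.euler y hy
  have h1 := DFunLike.congr_fun (heq.fderiv_eq (𝕜 := ℝ)) ζ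
  rw [(hq.hasFDerivAt.clm_apply hasFDerivAt_snd).fderiv, fderiv_const_mul hf] at h1
  simp at h1
  linarith

/-- The momentum has degree `d - 1`. For `d ≠ 1`, the orthogonal space of the velocity is therefore
the kernel of the momentum. -/
theorem fibreMetric_snd (b : E) : fibreMetric f z b z.2 = (d - 1) * vertD f z b := by
  have h1 := h.fderiv_euler hz (0, b)
  change fderiv ℝ (vertD f) z (0, b) z.2 = _
  have : fderiv ℝ f z (0, b) = vertD f z b := rfl
  rw [this] at h1
  simp only at h1
  linarith

theorem fderiv_vertD_horiz_snd (a : E) :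
    fderiv ℝ (vertD f) z (a, 0) z.2 = d * fderiv ℝ f z (a, 0) := by
  have h1 := h.fderiv_euler hz (a, 0)
  simpa using h1

variable [CompleteSpace E]

theorem localSpray_contDiffAt : ContDiffAt ℝ ∞ (localSpray f) z :=
  contDiffAt_snd.prodMk (h.accel_contDiffAt hz)

theorem fderiv_localSpray (X : E × E) :
    fderiv ℝ (localSpray f) z X = (X.2, fderiv ℝ (accel f) z X) := by
  have h1 : HasFDerivAt (localSpray f)
      ((ContinuousLinearMap.snd ℝ E E).prod (fderiv ℝ (accel f) z)) z :=
    hasFDerivAt_snd.prodMk ((h.accel_contDiffAt hz).differentiableAt (by simp)).hasFDerivAt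
  rw [h1.fderiv]; rfl

/-- The fibre derivative of the Euler–Lagrange equation. -/
theorem fderiv_eulerLagrange (b w : E) :
    fderiv ℝ (fibreMetric f) z (localSpray f z) b w + fderiv ℝ (vertD f) z (b, 0) w +
      fibreMetric f z (accelV f z b) w = fderiv ℝ (vertD f) z (w, 0) b := by
  have hq := contDiffAt_vertD (h.contDiffAt hz)
  have hq' := (contDiffAt_fderiv_of hq).differentiableAt (by simp)
  have hV := (h.localSpray_contDiffAt hz).differentiableAt (by simp)
  have heq : (fun y => fderiv ℝ (vertD f) y (localSpray f y) w) =ᶠ[𝓝 z]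
      fun y => fderiv ℝ f y (w, 0) := by
    filter_upwards [h.mem_nhds hz] with y hy
    exact h.eulerLagrange hy w
  have h1 := fderiv_fderiv_vert_horiz (h.contDiffAt hz) b w
  rw [← heq.fderiv_eq, fderiv_clm_apply_const w (hq'.clm_apply hV),
    (hq'.hasFDerivAt.clm_apply hV.hasFDerivAt).fderiv] at h1
  rw [← h1, h.fderiv_fibreMetric_apply hz, fderiv_symm_of_contDiffAt hq]
  simp only [add_apply, ContinuousLinearMap.comp_apply,
    ContinuousLinearMap.flip_apply, h.fderiv_localSpray hz]
  have e : ((b, fderiv ℝ (accel f) z (0, b)) : E × E) = (b, 0) + (0, accelV f z b) := by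
    simp [accelV]
  rw [e, map_add]
  simp only [add_apply, fibreMetric, ContinuousLinearMap.comp_apply,
    ContinuousLinearMap.inr_apply]
  ring

/-- The spray derivative of the fibre metric: the metric is parallel. -/
theorem fderiv_fibreMetric_spray (b w : E) :
    fderiv ℝ (fibreMetric f) z (localSpray f z) b w =
      -(1 / 2) * (fibreMetric f z (accelV f z b) w + fibreMetric f z b (accelV f z w)) := by
  have h1 := h.fderiv_eulerLagrange hz b w
  have h2 := h.fderiv_eulerLagrange hz w b
  rw [h.fderiv_fibreMetric_symm hz _ w b, fibreMetric_symm (h.contDiffAt hz) _ b] at h2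
  linarith

/-- In the difference of the linearized Euler–Lagrange equation and its transpose, the derivative of
the symmetric metric drops out. -/
theorem accelV_antisymm (b w : E) :
    fibreMetric f z (accelV f z b) w - fibreMetric f z b (accelV f z w) =
      2 * (fderiv ℝ (vertD f) z (w, 0) b - fderiv ℝ (vertD f) z (b, 0) w) := by
  have h1 := h.fderiv_eulerLagrange hz b w
  have h2 := h.fderiv_eulerLagrange hz w b
  rw [h.fderiv_fibreMetric_symm hz _ w b, fibreMetric_symm (h.contDiffAt hz) _ b] at h2
  linarith

-- Obtained by differentiating `g(v, w) = (d - 1) ∂f/∂v(w)` along the spray, where the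
-- Euler–Lagrange equation evaluates the right side.
omit [CompleteSpace E] in
theorem fderiv_fibreMetric_spray_snd (w : E) :
    fderiv ℝ (fibreMetric f) z (localSpray f z) z.2 w + fibreMetric f z (accel f z) w =
      (d - 1) * fderiv ℝ f z (w, 0) := by
  have hg := (contDiffAt_fibreMetric (h.contDiffAt hz)).differentiableAt (by simp)
  have hq := (contDiffAt_vertD (h.contDiffAt hz)).differentiableAt (by simp)
  have heq : (fun y : E × E => fibreMetric f y y.2 w) =ᶠ[𝓝 z] fun y => (d - 1) * vertD f y w := by
    filter_upwards [h.mem_nhds hz] with y hy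
    rw [fibreMetric_symm (h.contDiffAt hy)]
    exact h.fibreMetric_snd hy w
  have h1 := DFunLike.congr_fun (heq.fderiv_eq (𝕜 := ℝ)) (localSpray f z)
  rw [fderiv_clm_apply_const w (hg.clm_apply differentiableAt_snd),
    (hg.hasFDerivAt.clm_apply hasFDerivAt_snd).fderiv,
    fderiv_const_mul (hq.clm_apply (differentiableAt_const w))] at h1
  simp only [smul_apply, smul_eq_mul] at h1
  rw [fderiv_clm_apply_const w hq, h.eulerLagrange hz] at h1
  simp [localSpray] at h1 ⊢
  linarith

/-- Euler's relation of degree 2 for the spray acceleration, read off from the linearized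
Euler–Lagrange equation in the direction of the velocity. -/
theorem accelV_snd : accelV f z z.2 = (2 : ℝ) • accel f z := by
  rw [← sub_eq_zero]
  refine h.fibreMetric_eq_zero hz fun w => ?_
  have h1 := h.fderiv_eulerLagrange hz z.2 w
  have h2 := h.fderiv_fibreMetric_spray_snd hz w
  have h3 := h.fderiv_vertD_horiz_snd hz w
  have h4 := h.eulerLagrange hz w
  have e : localSpray f z = (z.2, 0) + (0, accel f z) := by simp [localSpray]
  rw [e, map_add] at h4
  have h5 : fderiv ℝ (vertD f) z (0, accel f z) = fibreMetric f z (accel f z) := rfl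
  rw [h5] at h4
  simp only [add_apply] at h4
  simp only [map_sub, map_smul, sub_apply, smul_apply,
    smul_eq_mul]
  linarith

/-- Equivalently, `f` has zero derivative along the horizontal vectors `(b, ½ ∂u/∂v(b))` of the
connection. -/
theorem vertD_accelV (hd : d ≠ 1) (b : E) :
    vertD f z (accelV f z b) = -2 * fderiv ℝ f z (b, 0) := by
  have h1 := h.fderiv_eulerLagrange hz b z.2
  have h2 := h.fderiv_fibreMetric_spray_snd hz b
  have h3 := h.fderiv_vertD_horiz_snd hz b
  have h4 := h.eulerLagrange hz b
  have h6 := h.fibreMetric_snd hz (accelV f z b)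
  have e : localSpray f z = (z.2, 0) + (0, accel f z) := by simp [localSpray]
  rw [e, map_add] at h4
  have h5 : fderiv ℝ (vertD f) z (0, accel f z) = fibreMetric f z (accel f z) := rfl
  rw [h5] at h4
  simp only [add_apply] at h4
  rw [h.fderiv_fibreMetric_symm hz] at h2
  have hd' : d - 1 ≠ 0 := sub_ne_zero.mpr hd
  apply mul_left_cancel₀ hd'
  linarith

/-- The second vertical derivative of the acceleration, in the direction of the argument. -/
theorem fderiv_accelV_snd (b : E) :
    fderiv ℝ (fderiv ℝ (accel f)) z (0, z.2) (0, b) = accelV f z b := by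
  have hu := h.accel_contDiffAt hz
  have hu' := (contDiffAt_fderiv_of hu).differentiableAt (by simp)
  have hv : HasFDerivAt (fun y : E × E => ((0, y.2) : E × E))
      ((ContinuousLinearMap.inr ℝ E E).comp (ContinuousLinearMap.snd ℝ E E)) z :=
    ((ContinuousLinearMap.inr ℝ E E).comp (ContinuousLinearMap.snd ℝ E E)).hasFDerivAt
  have heq : (fun y : E × E => fderiv ℝ (accel f) y (0, y.2)) =ᶠ[𝓝 z]
      fun y => (2 : ℝ) • accel f y := by
    filter_upwards [h.mem_nhds hz] with y hy
    exact h.accelV_snd hy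
  have h1 := DFunLike.congr_fun (heq.fderiv_eq (𝕜 := ℝ)) (0, b)
  rw [(hu'.hasFDerivAt.clm_apply hv).fderiv,
    fderiv_fun_const_smul (hu.differentiableAt (by simp))] at h1
  simp only [add_apply, ContinuousLinearMap.comp_apply,
    ContinuousLinearMap.flip_apply,
    ContinuousLinearMap.coe_snd', ContinuousLinearMap.inr_apply, two_smul] at h1
  rw [fderiv_symm_of_contDiffAt hu]
  exact add_left_cancel h1

end IsRegularOn

end Lagrangian

/-! ### The tidal force tensor and its trace -/

section Tidal

variable {E : Type*} [NormedAddCommGroup E] [NormedSpace ℝ E]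

theorem localConnection_apply (f : E × E → ℝ) (z X : E × E) :
    localConnection f z X = X.2 - (1 / 2 : ℝ) • accelV f z X.1 := by
  simp [localConnection, accelV, sub_eq_add_neg]

namespace IsRegularOn

variable [CompleteSpace E] {f : E × E → ℝ} {d : ℝ} {Ω : Set (E × E)} (h : IsRegularOn f d Ω)
  {z : E × E} (hz : z ∈ Ω)
include h hz

theorem accelV_contDiffAt : ContDiffAt ℝ ∞ (accelV f) z :=
  (contDiffAt_fderiv_of (h.accel_contDiffAt hz)).clm_comp contDiffAt_const

theorem fderiv_accelV (ζ : E × E) : fderiv ℝ (accelV f) z ζ =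
    (fderiv ℝ (fderiv ℝ (accel f)) z ζ).comp (ContinuousLinearMap.inr ℝ E E) :=
  fderiv_clm_comp_const _
    ((contDiffAt_fderiv_of (h.accel_contDiffAt hz)).differentiableAt (by simp)) ζ

/-- The spray derivative of the metric supplies exactly the correction `-½ ∂u/∂v` that turns the
vertical parts of `X` and `Y` into their images under `P`. -/
theorem lieD_horizMetric (X Y : E × E) :
    lieD (localSpray f) (horizMetric f) z X Y =
      fibreMetric f z (localConnection f z X) Y.1 +
        fibreMetric f z X.1 (localConnection f z Y) := by
  have hg := (contDiffAt_fibreMetric (h.contDiffAt hz)).differentiableAt (by simp)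
  have e : fderiv ℝ (fun y => horizMetric f y X Y) z (localSpray f z) =
      fderiv ℝ (fibreMetric f) z (localSpray f z) X.1 Y.1 := by
    unfold horizMetric
    rw [fderiv_clm_apply_const Y.1 (hg.clm_apply (differentiableAt_const X.1)),
      fderiv_clm_apply_const X.1 hg]
  unfold lieD
  rw [e, h.fderiv_fibreMetric_spray hz, h.fderiv_localSpray hz, h.fderiv_localSpray hz,
    localConnection_apply, localConnection_apply]
  simp [horizMetric]
  ring

/-- A second Lie derivative of the preceding formula. The symmetrized form on the right suffices for
traces, so self-adjointness of `tidalEnd` is never needed. -/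
theorem localTidal_horiz (a b : E) :
    localTidal f z (a, 0) (b, 0) = (1 / 2) *
      (fibreMetric f z (tidalEnd f z a) b + fibreMetric f z a (tidalEnd f z b)) := by
  have hg := (contDiffAt_fibreMetric (h.contDiffAt hz)).differentiableAt (by simp)
  have hA := (h.accelV_contDiffAt hz).differentiableAt (by simp)
  have hL : (fun y => lieD (localSpray f) (horizMetric f) y (a, 0) (b, 0)) =ᶠ[𝓝 z]
      fun y => -(1 / 2) * (fibreMetric f y (accelV f y a) b + fibreMetric f y a (accelV f y b)) := by
    filter_upwards [h.mem_nhds hz] with y hy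
    rw [h.lieD_horizMetric hy, localConnection_apply, localConnection_apply]
    simp
    ring
  have e1 : ∀ a b, HasFDerivAt (fun y => fibreMetric f y (accelV f y a) b) _ z := fun a b =>
    (hg.hasFDerivAt.clm_apply (hA.hasFDerivAt.clm_apply (hasFDerivAt_const a z))).clm_apply
      (hasFDerivAt_const b z)
  have e2 : ∀ a b, HasFDerivAt (fun y => fibreMetric f y a (accelV f y b)) _ z := fun a b =>
    (hg.hasFDerivAt.clm_apply (hasFDerivAt_const a z)).clm_apply
      (hA.hasFDerivAt.clm_apply (hasFDerivAt_const b z))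
  have hder := DFunLike.congr_fun ((hL.fderiv_eq (𝕜 := ℝ)).trans
    ((((e1 a b).add (e2 a b)).const_mul (-(1 / 2))).fderiv)) (localSpray f z)
  unfold localTidal
  rw [lieD, hder, h.fderiv_localSpray hz, h.fderiv_localSpray hz, h.lieD_horizMetric hz,
    h.lieD_horizMetric hz]
  simp only [localConnection_apply, tidalEnd, add_apply, smul_apply,
    ContinuousLinearMap.comp_apply, ContinuousLinearMap.flip_apply, h.fderiv_accelV hz,
    ContinuousLinearMap.inr_apply, ContinuousLinearMap.inl_apply, zero_apply,
    map_zero, map_add, map_smul, smul_eq_mul, zero_sub, sub_zero, smul_zero, map_neg, neg_apply, zero_add, h.fderiv_fibreMetric_spray hz]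
  ring

end IsRegularOn

/-- In matrices `S = ½ (Kᵀ G + G K)`, and both terms of `G⁻¹ S` have half the trace of `K`. This
links the energy condition to Raychaudhuri's equation. -/
theorem localTidalTrace_eq {n : ℕ} {f : Eu n × Eu n → ℝ} {d : ℝ} {Ω : Set (Eu n × Eu n)}
    (h : IsRegularOn f d Ω) {z : Eu n × Eu n} (hz : z ∈ Ω) :
    localTidalTrace f z = LinearMap.trace ℝ (Eu n) (tidalEnd f z).toLinearMap := by
  let e := (EuclideanSpace.basisFun (Fin n) ℝ).toBasis
  have he : ∀ i, e i = EuclideanSpace.single i (1 : ℝ) := fun i => by simp [e]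
  set K := LinearMap.toMatrix e e (tidalEnd f z).toLinearMap with hK
  set Gm : Matrix (Fin n) (Fin n) ℝ := Matrix.of fun i j : Fin n =>
      fibreMetric f z (EuclideanSpace.single i 1) (EuclideanSpace.single j 1) with hGm
  have hcol : ∀ j, tidalEnd f z (EuclideanSpace.single j 1) =
      ∑ i, K i j • EuclideanSpace.single i (1 : ℝ) := by
    intro j
    have := e.sum_repr (tidalEnd f z (EuclideanSpace.single j 1))
    rw [← this]
    refine Finset.sum_congr rfl fun i _ => ?_
    rw [he, hK, LinearMap.toMatrix_apply, he]
    rfl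
  have hS : (Matrix.of fun i j : Fin n =>
      localTidal f z (EuclideanSpace.single i 1, 0) (EuclideanSpace.single j 1, 0)) =
      (1 / 2 : ℝ) • (K.transpose * Gm + Gm * K) := by
    ext i j
    simp only [Matrix.of_apply, Matrix.smul_apply, Matrix.add_apply, Matrix.mul_apply,
      Matrix.transpose_apply, smul_eq_mul]
    rw [h.localTidal_horiz hz, hcol i, hcol j]
    simp [hGm, mul_comm]
  have hunit : IsUnit Gm.det := by
    rw [isUnit_iff_ne_zero]
    intro hdet
    obtain ⟨c, hc0, hc⟩ := Matrix.exists_vecMul_eq_zero_iff.mpr hdet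
    have hz0 : (∑ i, c i • EuclideanSpace.single i (1 : ℝ) : Eu n) = 0 := by
      refine h.fibreMetric_eq_zero hz fun b => ?_
      have hb : b = ∑ j, b j • EuclideanSpace.single j (1 : ℝ) := by
        conv_lhs => rw [← e.sum_repr b]
        simp [e]
      rw [hb, map_sum]
      refine Finset.sum_eq_zero fun j _ => ?_
      have := congrFun hc j
      simp only [Matrix.vecMul, dotProduct, hGm, Matrix.of_apply, Pi.zero_apply] at this
      simp [this]
    apply hc0
    ext j
    have := congrArg (fun x : Eu n => x j) hz0
    simpa [Finset.sum_apply, Pi.single_apply] using this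
  unfold localTidalTrace
  rw [← hGm, hS, LinearMap.trace_eq_matrix_trace ℝ e, ← hK, Matrix.mul_smul, Matrix.mul_add,
    ← Matrix.mul_assoc, ← Matrix.mul_assoc, Matrix.nonsing_inv_mul _ hunit, Matrix.one_mul,
    Matrix.trace_smul, Matrix.trace_add, Matrix.trace_mul_comm, ← Matrix.mul_assoc,
    Matrix.mul_nonsing_inv _ hunit, Matrix.one_mul, Matrix.trace_transpose]
  simp
  ring

end Tidal

/-! ### The endomorphism of a congruence and Raychaudhuri's equation -/

section Expansion

variable {E : Type*} [NormedAddCommGroup E] [NormedSpace ℝ E]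

/-- The endomorphism `X ↦ P(κ_* X)` of a vector field `κ`. -/
def fieldEnd (f : E × E → ℝ) (κ : E → E) (x : E) : E →L[ℝ] E :=
  fderiv ℝ κ x - (1 / 2 : ℝ) • accelV f (x, κ x)

variable (E) in
/-- The trace as a continuous linear form. -/
def traceL [FiniteDimensional ℝ E] : (E →L[ℝ] E) →L[ℝ] ℝ :=
  LinearMap.toContinuousLinearMap ((LinearMap.trace ℝ E) ∘ₗ ContinuousLinearMap.coeLM ℝ)

theorem traceL_apply [FiniteDimensional ℝ E] (A : E →L[ℝ] E) :
    traceL E A = LinearMap.trace ℝ E A.toLinearMap := rfl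

theorem traceL_comp_comm [FiniteDimensional ℝ E] (A B : E →L[ℝ] E) :
    traceL E (A.comp B) = traceL E (B.comp A) :=
  LinearMap.trace_comp_comm' B.toLinearMap A.toLinearMap

theorem traceL_smulRight [FiniteDimensional ℝ E] (l : E →L[ℝ] ℝ) (v : E) :
    traceL E (l.smulRight v) = l v :=
  LinearMap.trace_smulRight l.toLinearMap v

namespace IsRegularOn

variable {f : E × E → ℝ} {d : ℝ} {Ω : Set (E × E)} (h : IsRegularOn f d Ω)
  {κ : E → E} {x : E} (hκ : ContDiffAt ℝ ∞ κ x) (hz : (x, κ x) ∈ Ω)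
include h hκ hz

-- Degree 2 of the acceleration makes the connection term equal to `u`, so `B κ = Dκ κ - u`.
omit hκ in
theorem fieldEnd_self [CompleteSpace E] {r : ℝ}
    (hr : accel f (x, κ x) - fderiv ℝ κ x (κ x) = r • κ x) :
    fieldEnd f κ x (κ x) = -r • κ x := by
  have := h.accelV_snd hz
  simp only at this
  rw [fieldEnd, sub_apply, smul_apply, this, smul_smul, neg_smul, ← hr]
  norm_num

/-- The push-forward `κ_* X` is tangent to the null cone, and its horizontal part has zero
`f`-derivative by `vertD_accelV`; so has its vertical part. -/
theorem vertD_fieldEnd [CompleteSpace E] (hd : d ≠ 1) (hf : ∀ᶠ y in 𝓝 x, f (y, κ y) = 0) (X : E) :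
    vertD f (x, κ x) (fieldEnd f κ x X) = 0 := by
  have h1 := h.vertD_accelV hz hd X
  have hf' := ((h.contDiffAt hz).differentiableAt (by simp)).hasFDerivAt
  have hk := (hκ.differentiableAt (by simp)).hasFDerivAt
  have hcomp : HasFDerivAt (fun y => f (y, κ y))
      ((fderiv ℝ f (x, κ x)).comp ((ContinuousLinearMap.id ℝ E).prod (fderiv ℝ κ x))) x :=
    hf'.comp x ((hasFDerivAt_id x).prodMk hk)
  have h0 : (fderiv ℝ f (x, κ x)).comp ((ContinuousLinearMap.id ℝ E).prod (fderiv ℝ κ x)) = 0 := by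
    rw [← hcomp.fderiv]
    have : (fun y => f (y, κ y)) =ᶠ[𝓝 x] fun _ => 0 := hf
    rw [this.fderiv_eq]; simp
  have h2 := DFunLike.congr_fun h0 X
  simp only [ContinuousLinearMap.comp_apply, ContinuousLinearMap.prod_apply,
    ContinuousLinearMap.id_apply, zero_apply] at h2
  have e : ((X, fderiv ℝ κ x X) : E × E) = (X, 0) + (0, fderiv ℝ κ x X) := by simp
  rw [e, map_add] at h2
  have h3 : fderiv ℝ f (x, κ x) (0, fderiv ℝ κ x X) = vertD f (x, κ x) (fderiv ℝ κ x X) := rfl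
  rw [fieldEnd, sub_apply, smul_apply, map_sub, map_smul, h1, ← h3, smul_eq_mul]
  linarith

omit hκ in
theorem fderiv_localContact (X Y : E × E) :
    fderiv ℝ (localContact f) (x, κ x) X Y = fderiv ℝ (vertD f) (x, κ x) X Y.1 := by
  have := fderiv_clm_comp_const (ContinuousLinearMap.fst ℝ E E)
    ((contDiffAt_vertD (h.contDiffAt hz)).differentiableAt (by simp)) X
  have h2 : fderiv ℝ (localContact f) (x, κ x) X =
    (fderiv ℝ (vertD f) (x, κ x) X).comp (ContinuousLinearMap.fst ℝ E E) := this
  rw [h2]; rfl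

-- The horizontal contributions to `dα` are absorbed by `accelV_antisymm`. On the section, `dα` thus
-- measures the failure of `B` to be symmetric.
omit hκ in
theorem localContactD_field [CompleteSpace E] (X Y : E) :
    localContactD f (x, κ x) (X, fderiv ℝ κ x X) (Y, fderiv ℝ κ x Y) =
      fibreMetric f (x, κ x) (fieldEnd f κ x X) Y -
        fibreMetric f (x, κ x) X (fieldEnd f κ x Y) := by
  have h1 := h.accelV_antisymm hz X Y
  have e : ∀ X Y, fderiv ℝ (vertD f) (x, κ x) (X, fderiv ℝ κ x X) Y =
      fderiv ℝ (vertD f) (x, κ x) (X, 0) Y + fibreMetric f (x, κ x) (fderiv ℝ κ x X) Y := by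
    intro X Y
    have e : ((X, fderiv ℝ κ x X) : E × E) = (X, 0) + (0, fderiv ℝ κ x X) := by simp
    rw [e, map_add]; rfl
  rw [localContactD, h.fderiv_localContact hz, h.fderiv_localContact hz, e, e]
  simp only [fieldEnd, sub_apply, smul_apply, map_sub, map_smul, smul_eq_mul]
  rw [fibreMetric_symm (h.contDiffAt hz) X (fderiv ℝ κ x Y)]
  linarith

/-- The Raychaudhuri equation for a pregeodesic vector field. -/
theorem raychaudhuri [FiniteDimensional ℝ E] {r : E → ℝ} (hr : DifferentiableAt ℝ r x)
    (hgeo : ∀ᶠ y in 𝓝 x, accel f (y, κ y) - fderiv ℝ κ y (κ y) = r y • κ y) :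
    ∃ β' : E →L[ℝ] ℝ,
      HasFDerivAt (fun y => traceL E (fieldEnd f κ y) + r y) β' x ∧
      β' (κ x) + r x * (traceL E (fieldEnd f κ x) + r x) =
        traceL E (tidalEnd f (x, κ x)) -
          (traceL E ((fieldEnd f κ x).comp (fieldEnd f κ x)) - r x ^ 2) := by
  have hk := (hκ.differentiableAt (by simp)).hasFDerivAt
  have hk' := ((contDiffAt_fderiv_of hκ).differentiableAt (by simp)).hasFDerivAt
  have hpair : HasFDerivAt (fun y => (y, κ y))
      ((ContinuousLinearMap.id ℝ E).prod (fderiv ℝ κ x)) x := (hasFDerivAt_id x).prodMk hk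
  have hu := ((h.accel_contDiffAt hz).differentiableAt (by simp)).hasFDerivAt
  have hA := ((h.accelV_contDiffAt hz).differentiableAt (by simp)).hasFDerivAt
  have hu1 : HasFDerivAt (fun y => accel f (y, κ y)) ((fderiv ℝ (accel f) (x, κ x)).comp
      ((ContinuousLinearMap.id ℝ E).prod (fderiv ℝ κ x))) x := HasFDerivAt.comp (f := fun y => (y, κ y)) x hu hpair
  have hA1 : HasFDerivAt (fun y => accelV f (y, κ y)) ((fderiv ℝ (accelV f) (x, κ x)).comp
      ((ContinuousLinearMap.id ℝ E).prod (fderiv ℝ κ x))) x := HasFDerivAt.comp (f := fun y => (y, κ y)) x hA hpair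
  have hB : HasFDerivAt (fieldEnd f κ) _ x := hk'.sub (hA1.const_smul (1 / 2 : ℝ))
  have hβ := ((traceL E).hasFDerivAt.comp x hB).add hr.hasFDerivAt
  refine ⟨_, hβ, ?_⟩
  set A := accelV f (x, κ x) with hAdef
  set D := fderiv ℝ κ x with hD
  set ux := (fderiv ℝ (accel f) (x, κ x)).comp (ContinuousLinearMap.inl ℝ E E) with hux
  set VA := (fderiv ℝ (fderiv ℝ (accel f)) (x, κ x) (localSpray f (x, κ x))).comp
      (ContinuousLinearMap.inr ℝ E E) with hVA
  have hDκ : D (κ x) = accel f (x, κ x) - r x • κ x := by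
    rw [← hgeo.self_of_nhds]; abel
  -- The geodesic equation `Dκ κ = u - r κ` differentiated in a direction `X`; symmetry of the
  -- second derivative makes it the derivative of `Dκ` along `κ`.
  have hsecond : fderiv ℝ (fderiv ℝ κ) x (κ x) = ux + A.comp D - r x • D -
      (fderiv ℝ r x).smulRight (κ x) - D.comp D := by
    have heq : (fun y => fderiv ℝ κ y (κ y)) =ᶠ[𝓝 x] fun y => accel f (y, κ y) - r y • κ y := by
      filter_upwards [hgeo] with y hy
      rw [← hy]; abel
    have h1 := heq.fderiv_eq (𝕜 := ℝ)
    rw [(hk'.clm_apply hk).fderiv, (hu1.fun_sub (hr.hasFDerivAt.fun_smul hk)).fderiv] at h1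
    ext X
    have h2 := DFunLike.congr_fun h1 X
    have e : ((X, D X) : E × E) = (X, 0) + (0, D X) := by simp
    simp only [add_apply, ContinuousLinearMap.comp_apply, ContinuousLinearMap.flip_apply,
      sub_apply, ContinuousLinearMap.prod_apply, ContinuousLinearMap.id_apply, ← hD, e,
      map_add, smul_apply, ContinuousLinearMap.smulRight_apply] at h2
    rw [fderiv_symm_of_contDiffAt hκ]
    simp only [add_apply, ContinuousLinearMap.comp_apply, sub_apply, smul_apply,
      ContinuousLinearMap.smulRight_apply, hux, hAdef, accelV, ContinuousLinearMap.inl_apply,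
      ContinuousLinearMap.inr_apply]
    rw [← sub_eq_zero] at h2 ⊢
    refine Eq.trans ?_ h2
    abel
  -- The lift of `κ` differs from the spray by `r` times the radial vector, along which `∂u/∂v` has
  -- degree 1.
  have hVert : fderiv ℝ (accelV f) (x, κ x) (κ x, D (κ x)) = VA - r x • A := by
    have e : ((κ x, D (κ x)) : E × E) = localSpray f (x, κ x) - r x • (0, κ x) := by
      simp [localSpray, hDκ]
    rw [e, map_sub, map_smul, h.fderiv_accelV hz, h.fderiv_accelV hz]
    congr 2
    ext b
    exact h.fderiv_accelV_snd hz b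
  have hcomm : traceL E (D.comp A) = traceL E (A.comp D) := traceL_comp_comm D A
  have hBB : traceL E ((fieldEnd f κ x).comp (fieldEnd f κ x)) =
      traceL E (D.comp D) - traceL E (A.comp D) + (1 / 4) * traceL E (A.comp A) := by
    have : (fieldEnd f κ x).comp (fieldEnd f κ x) = D.comp D - (1 / 2 : ℝ) • D.comp A -
        (1 / 2 : ℝ) • A.comp D + (1 / 4 : ℝ) • A.comp A := by
      ext X
      simp only [fieldEnd, ← hD, ← hAdef, ContinuousLinearMap.comp_apply, sub_apply, add_apply,
        smul_apply, map_sub, map_smul]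
      module
    rw [this]
    simp only [map_add, map_sub, map_smul, smul_eq_mul, hcomm]
    ring
  have hK : traceL E (tidalEnd f (x, κ x)) =
      traceL E ux - (1 / 2) * traceL E VA + (1 / 4) * traceL E (A.comp A) := by
    have : tidalEnd f (x, κ x) = ux - (1 / 2 : ℝ) • VA + (1 / 4 : ℝ) • A.comp A := by
      ext X
      simp only [tidalEnd, ← hux, ← hVA, ← hAdef, ContinuousLinearMap.comp_apply, sub_apply,
        add_apply, smul_apply, map_smul]
      module
    rw [this]
    simp only [map_add, map_sub, map_smul, smul_eq_mul]
  have hB1 : traceL E (fieldEnd f κ x) = traceL E D - (1 / 2) * traceL E A := by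
    simp only [fieldEnd, ← hD, ← hAdef, map_sub, map_smul, smul_eq_mul]
  simp only [add_apply, ContinuousLinearMap.comp_apply, sub_apply, smul_apply,
    ContinuousLinearMap.prod_apply, ContinuousLinearMap.id_apply]
  rw [hVert, hsecond, hBB, hK, hB1]
  simp only [map_add, map_sub, map_smul, smul_eq_mul, traceL_smulRight]
  ring

end IsRegularOn

end Expansion

/-! ### Behaviour of sprays and expansions under coordinate changes and rescaling -/

section Transform

variable {E : Type*} [NormedAddCommGroup E] [NormedSpace ℝ E]

/-- The map `(x, v) ↦ (φ x, t Dφ v)` induced by a map of the base and a scaling. -/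
def tangentLift (φ : E → E) (t : ℝ) (z : E × E) : E × E := (φ z.1, t • fderiv ℝ φ z.1 z.2)

theorem hasFDerivAt_tangentLift {φ : E → E} {z : E × E} (hφ : ContDiffAt ℝ ∞ φ z.1) (t : ℝ) :
    ∃ L : E × E →L[ℝ] E × E, HasFDerivAt (tangentLift φ t) L z ∧ ∀ ζ : E × E,
      L ζ = (fderiv ℝ φ z.1 ζ.1,
        t • (fderiv ℝ (fderiv ℝ φ) z.1 ζ.1 z.2 + fderiv ℝ φ z.1 ζ.2)) := by
  have h1 : HasFDerivAt (fun y : E × E => φ y.1) _ z :=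
    ((hφ.differentiableAt (by simp)).hasFDerivAt).comp z hasFDerivAt_fst
  have h2 : HasFDerivAt (fun y : E × E => fderiv ℝ φ y.1) _ z :=
    (((contDiffAt_fderiv_of hφ).differentiableAt (by simp)).hasFDerivAt).comp z hasFDerivAt_fst
  refine ⟨_, h1.prodMk ((h2.clm_apply hasFDerivAt_snd).const_smul t), fun ζ => ?_⟩
  simp [add_comm]

/-- The spray acceleration transforms as that of a second order differential equation. -/
theorem accel_tangentLift [CompleteSpace E] {f f' : E × E → ℝ} {d d' : ℝ} {Ω Ω' : Set (E × E)}
    (h : IsRegularOn f d Ω) (h' : IsRegularOn f' d' Ω') {φ : E → E} {t c : ℝ}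
    {z : E × E} (hz : z ∈ Ω) (hz' : tangentLift φ t z ∈ Ω')
    (hφ : ∀ᶠ y in 𝓝 z.1, ContDiffAt ℝ ∞ φ y) (hsurj : Function.Surjective (fderiv ℝ φ z.1))
    (heq : ∀ᶠ y in 𝓝 z, f' (tangentLift φ t y) = c * f y) :
    accel f' (tangentLift φ t z) =
      t ^ 2 • (fderiv ℝ φ z.1 (accel f z) + fderiv ℝ (fderiv ℝ φ) z.1 z.2 z.2) := by
  have hφ0 := hφ.self_of_nhds
  have hφz : ∀ᶠ y : E × E in 𝓝 z, ContDiffAt ℝ ∞ φ y.1 := continuousAt_fst.eventually hφ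
  obtain ⟨LΦ, hLΦ, hL⟩ := hasFDerivAt_tangentLift hφ0 t
  have hmem : ∀ᶠ y in 𝓝 z, tangentLift φ t y ∈ Ω' :=
    hLΦ.continuousAt.eventually (h'.mem_nhds hz')
  have step : ∀ᶠ y in 𝓝 z, ∀ ζ : E × E, fderiv ℝ f' (tangentLift φ t y) (fderiv ℝ φ y.1 ζ.1,
        t • (fderiv ℝ (fderiv ℝ φ) y.1 ζ.1 y.2 + fderiv ℝ φ y.1 ζ.2)) = c * fderiv ℝ f y ζ := by
    filter_upwards [heq.eventually_nhds, hφz, hmem, h.mem_nhds hz] with y hy1 hy2 hy3 hy4 ζ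
    obtain ⟨L', hL', hL''⟩ := hasFDerivAt_tangentLift hy2 t
    have e1 : HasFDerivAt (fun y => f' (tangentLift φ t y)) _ y :=
      HasFDerivAt.comp y ((h'.contDiffAt hy3).differentiableAt (by simp)).hasFDerivAt hL'
    have e2 : HasFDerivAt (fun y => c * f y) _ y :=
      ((h.contDiffAt hy4).differentiableAt (by simp)).hasFDerivAt.const_mul c
    have e3 := DFunLike.congr_fun ((e1.congr_of_eventuallyEq
      (Filter.EventuallyEq.symm hy1)).unique e2) ζ
    rw [ContinuousLinearMap.comp_apply, hL''] at e3
    simpa using e3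
  have hvert : ∀ w, ∀ᶠ y in 𝓝 z, t * vertD f' (tangentLift φ t y) (fderiv ℝ φ y.1 w) =
      c * vertD f y w := by
    intro w
    filter_upwards [step] with y hy
    have e : ((0, t • fderiv ℝ φ y.1 w) : E × E) = t • (0, fderiv ℝ φ y.1 w) := by simp
    have := hy (0, w)
    simp only [map_zero, zero_apply, zero_add] at this
    rw [e, map_smul] at this
    exact this
  have hhoriz : ∀ w, fderiv ℝ f' (tangentLift φ t z) (fderiv ℝ φ z.1 w, 0) +
      t * vertD f' (tangentLift φ t z) (fderiv ℝ (fderiv ℝ φ) z.1 w z.2) =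
      c * fderiv ℝ f z (w, 0) := by
    intro w
    have := step.self_of_nhds (w, 0)
    have e : ((fderiv ℝ φ z.1 w, t • fderiv ℝ (fderiv ℝ φ) z.1 w z.2) : E × E) =
      (fderiv ℝ φ z.1 w, 0) + t • (0, fderiv ℝ (fderiv ℝ φ) z.1 w z.2) := by simp
    simp only [map_zero, add_zero] at this
    rw [e, map_add, map_smul] at this
    exact this
  symm
  rw [← eulerLagrange_iff (h'.invertible _ hz')]
  intro w'
  obtain ⟨w, rfl⟩ := hsurj w'
  have hq' := ((contDiffAt_vertD (h'.contDiffAt hz')).differentiableAt (by simp)).hasFDerivAt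
  have hq := ((contDiffAt_vertD (h.contDiffAt hz)).differentiableAt (by simp)).hasFDerivAt
  have hDφ : HasFDerivAt (fun y : E × E => fderiv ℝ φ y.1) _ z :=
    (((contDiffAt_fderiv_of hφ0).differentiableAt (by simp)).hasFDerivAt).comp z hasFDerivAt_fst
  have e1 : HasFDerivAt (fun y => t * vertD f' (tangentLift φ t y) (fderiv ℝ φ y.1 w)) _ z :=
    ((HasFDerivAt.comp z hq' hLΦ).clm_apply
      (hDφ.clm_apply (hasFDerivAt_const w z))).const_mul t
  have e2 : HasFDerivAt (fun y => c * vertD f y w) _ z :=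
    (hq.clm_apply (hasFDerivAt_const w z)).const_mul c
  have e3 := DFunLike.congr_fun ((e1.congr_of_eventuallyEq
      -- The relation between the momenta is differentiated along the spray of `f`; the
      -- Euler–Lagrange equation of `f` then becomes that of `f'` at the image point.
      (Filter.EventuallyEq.symm (hvert w))).unique e2) (localSpray f z)
  simp only [smul_apply, add_apply, ContinuousLinearMap.comp_apply,
    ContinuousLinearMap.flip_apply, hL, zero_apply, map_zero, zero_add,
    h.eulerLagrange hz, Function.comp_apply, ContinuousLinearMap.coe_fst', smul_eq_mul] at e3
  have e4 := hhoriz w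
  have e5 : ((tangentLift φ t z).2, t ^ 2 • ((fderiv ℝ φ z.1) (accel f z) +
      fderiv ℝ (fderiv ℝ φ) z.1 z.2 z.2)) = t • ((fderiv ℝ φ z.1 z.2, t •
      (fderiv ℝ (fderiv ℝ φ) z.1 z.2 z.2 + fderiv ℝ φ z.1 (accel f z))) : E × E) := by
    simp [tangentLift, sq, smul_smul, add_comm]
  rw [e5, map_smul, smul_apply, smul_eq_mul]
  have e6 : fderiv ℝ (fderiv ℝ φ) z.1 w z.2 = fderiv ℝ (fderiv ℝ φ) z.1 z.2 w :=
    fderiv_symm_of_contDiffAt hφ0 _ _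
  rw [e6] at e4
  simp only [localSpray] at e3
  linarith

/-- The vector field `κ` is pregeodesic at `x`, with expansion `b`. -/
def HasExpansion [FiniteDimensional ℝ E] (f : E × E → ℝ) (κ : E → E) (x : E) (b : ℝ) : Prop :=
  ∃ r : ℝ, accel f (x, κ x) - fderiv ℝ κ x (κ x) = r • κ x ∧ b = traceL E (fieldEnd f κ x) + r

/-- The pregeodesic factor is determined because the field does not vanish. -/
theorem HasExpansion.unique [FiniteDimensional ℝ E] {f : E × E → ℝ} {κ : E → E} {x : E}
    {b b' : ℝ} (hx : κ x ≠ 0) (h : HasExpansion f κ x b) (h' : HasExpansion f κ x b') :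
    b = b' := by
  obtain ⟨r, h1, rfl⟩ := h
  obtain ⟨r', h1', rfl⟩ := h'
  rw [smul_left_injective ℝ hx (h1.symm.trans h1')]

/-- A linear form that is nonzero on `w x` exhibits `s` as a quotient near `x`. This gives
regularity of proportionality factors that are only chosen pointwise. -/
theorem differentiableAt_of_smul_eq {F : Type*} [NormedAddCommGroup F] [NormedSpace ℝ F]
    {a w : F → E} {s : F → ℝ} {x : F} (ha : DifferentiableAt ℝ a x) (hw : DifferentiableAt ℝ w x)
    (hwx : w x ≠ 0) (h : ∀ᶠ y in 𝓝 x, a y = s y • w y) : DifferentiableAt ℝ s x := by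
  obtain ⟨l, -, hl⟩ := exists_dual_vector ℝ (w x) (norm_ne_zero_iff.mpr hwx)
  have hl0 : l (w x) ≠ 0 := by rw [hl]; simpa using hwx
  have hlw : DifferentiableAt ℝ (fun y => l (w y)) x := l.differentiableAt.comp x hw
  have hla : DifferentiableAt ℝ (fun y => l (a y)) x := l.differentiableAt.comp x ha
  refine (hla.mul (hlw.inv hl0)).congr_of_eventuallyEq ?_
  filter_upwards [h, hlw.continuousAt.eventually_ne hl0] with y hy hy0
  simp [hy, hy0]

/-- The expansion does not depend on coordinates, and scales with the vector field. -/
theorem HasExpansion.transport [FiniteDimensional ℝ E] {f f' : E × E → ℝ} {φ : E → E}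
    {κ κ' : E → E} {s : E → ℝ} {x : E} {b : ℝ} (hx : κ x ≠ 0) (hb : HasExpansion f κ x b)
    (hs : s x ≠ 0) (hφ : ContDiffAt ℝ ∞ φ x) (hinv : (fderiv ℝ φ x).IsInvertible)
    (hκ : DifferentiableAt ℝ κ x) (hκ' : DifferentiableAt ℝ κ' (φ x))
    (hκκ : ∀ᶠ y in 𝓝 x, κ' (φ y) = s y • fderiv ℝ φ y (κ y))
    (hf : DifferentiableAt ℝ (accel f) (x, κ x))
    (hf' : DifferentiableAt ℝ (accel f') (φ x, κ' (φ x)))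
    (hacc : ∀ᶠ v in 𝓝 (κ x), accel f' (φ x, s x • fderiv ℝ φ x v) =
      s x ^ 2 • (fderiv ℝ φ x (accel f (x, v)) + fderiv ℝ (fderiv ℝ φ) x v v)) :
    HasExpansion f' κ' (φ x) (s x * b) := by
  obtain ⟨r, hr, rfl⟩ := hb
  obtain ⟨e, he⟩ := hinv
  set A := fderiv ℝ φ x with hA
  have hφ1 := (hφ.differentiableAt (by simp)).hasFDerivAt
  have hφ2 := ((contDiffAt_fderiv_of hφ).differentiableAt (by simp)).hasFDerivAt
  have hκx : κ' (φ x) = s x • A (κ x) := hκκ.self_of_nhds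
  have hAκ : A (κ x) ≠ 0 := by
    rw [← he]; intro h0; exact hx (e.injective (h0.trans (map_zero e).symm))
  have hw := hφ2.clm_apply hκ.hasFDerivAt
  have hsd : DifferentiableAt ℝ s x :=
    differentiableAt_of_smul_eq (a := fun y => κ' (φ y)) (w := fun y => fderiv ℝ φ y (κ y))
      (hκ'.comp x hφ1.differentiableAt) hw.differentiableAt hAκ hκκ
  have hD : ∀ X, fderiv ℝ κ' (φ x) (A X) = s x • (A (fderiv ℝ κ x X) +
      fderiv ℝ (fderiv ℝ φ) x X (κ x)) + fderiv ℝ s x X • A (κ x) := by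
    intro X
    have e1 : HasFDerivAt (fun y => κ' (φ y)) _ x := hκ'.hasFDerivAt.comp x hφ1
    have e2 := DFunLike.congr_fun ((e1.congr_of_eventuallyEq
      (Filter.EventuallyEq.symm hκκ)).unique (hsd.hasFDerivAt.fun_smul hw)) X
    simpa using e2
  have hpairv : HasFDerivAt (fun v : E => (x, v)) (ContinuousLinearMap.inr ℝ E E) (κ x) :=
    (hasFDerivAt_const x (κ x)).prodMk (hasFDerivAt_id (κ x))
  have hV : ∀ X, accelV f' (φ x, κ' (φ x)) (A X) =
      s x • (A (accelV f (x, κ x) X) + (2 : ℝ) • fderiv ℝ (fderiv ℝ φ) x X (κ x)) := by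
    intro X
    have e0 : HasFDerivAt (fun v : E => (φ x, s x • A v))
        ((ContinuousLinearMap.inr ℝ E E).comp (s x • A)) (κ x) :=
      (hasFDerivAt_const (φ x) (κ x)).prodMk (A.hasFDerivAt.const_smul (s x)) |>.congr_fderiv
        (by ext <;> simp)
    have e1 : HasFDerivAt (fun v => accel f' (φ x, s x • A v)) _ (κ x) :=
      HasFDerivAt.comp (g := accel f') (f := fun v : E => (φ x, s x • A v)) (κ x)
        (by rw [← hκx]; exact hf'.hasFDerivAt) e0
    have e2 : HasFDerivAt (fun v => A (accel f (x, v))) _ (κ x) :=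
      A.hasFDerivAt.comp (κ x) (HasFDerivAt.comp (f := fun v : E => (x, v)) (κ x)
        hf.hasFDerivAt hpairv)
    have e3 : HasFDerivAt (fun v => fderiv ℝ (fderiv ℝ φ) x v v) _ (κ x) :=
      (fderiv ℝ (fderiv ℝ φ) x).hasFDerivAt.clm_apply (hasFDerivAt_id (κ x))
    have e4 := DFunLike.congr_fun ((e1.congr_of_eventuallyEq
      (Filter.EventuallyEq.symm hacc)).unique ((e2.add e3).const_smul (s x ^ 2))) X
    simp only [ContinuousLinearMap.comp_apply, smul_apply, add_apply,
      ContinuousLinearMap.flip_apply, ContinuousLinearMap.inr_apply,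
      ContinuousLinearMap.id_apply] at e4
    rw [fderiv_symm_of_contDiffAt hφ (κ x) X] at e4
    have e5 : ((0, s x • A X) : E × E) = s x • (0, A X) := by simp
    rw [e5, map_smul] at e4
    have e6 : fderiv ℝ (accel f') (φ x, κ' (φ x)) (0, A X) = accelV f' (φ x, κ' (φ x)) (A X) := rfl
    have e7 : fderiv ℝ (accel f) (x, κ x) (0, X) = accelV f (x, κ x) X := rfl
    rw [e6, e7] at e4
    refine smul_right_injective E hs ?_
    simp only
    rw [e4]
    module
  -- The second derivatives of `φ` in `hD` and `hV` cancel, because of the factor `½` in the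
  -- connection; only the derivative of `s` remains.
  have hF : (fieldEnd f' κ' (φ x)).comp A = s x • A.comp (fieldEnd f κ x) +
      (fderiv ℝ s x).smulRight (A (κ x)) := by
    ext X
    simp only [fieldEnd, ContinuousLinearMap.comp_apply, sub_apply, smul_apply, add_apply,
      ContinuousLinearMap.smulRight_apply, hD, hV, map_sub, map_smul]
    module
  -- The new factor loses `ds(κ)`, precisely what the trace of the rank-one term above gains.
  refine ⟨s x * r - fderiv ℝ s x (κ x), ?_, ?_⟩
  · have e1 : accel f' (φ x, κ' (φ x)) = s x ^ 2 • (A (accel f (x, κ x)) +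
        fderiv ℝ (fderiv ℝ φ) x (κ x) (κ x)) := by
      rw [hκx]; exact hacc.self_of_nhds
    have e2 : accel f (x, κ x) = fderiv ℝ κ x (κ x) + r • κ x := by rw [← hr]; abel
    rw [e1, e2, hκx, map_smul, hD, map_add, map_smul]
    module
  · have hinvA : (e.symm : E →L[ℝ] E).comp A = ContinuousLinearMap.id ℝ E := by
      ext X; simp [← he]
    have hinvA' : A.comp (e.symm : E →L[ℝ] E) = ContinuousLinearMap.id ℝ E := by
      ext X; simp [← he]
    have e1 : fieldEnd f' κ' (φ x) = ((fieldEnd f' κ' (φ x)).comp A).comp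
        (e.symm : E →L[ℝ] E) := by
      rw [ContinuousLinearMap.comp_assoc, hinvA', ContinuousLinearMap.comp_id]
    rw [e1, traceL_comp_comm, hF, ContinuousLinearMap.comp_add, ContinuousLinearMap.comp_smul,
      ← ContinuousLinearMap.comp_assoc, hinvA, ContinuousLinearMap.id_comp, map_add, map_smul,
      traceL_comp_comm]
    have e2 : ((fderiv ℝ s x).smulRight (A (κ x))).comp (e.symm : E →L[ℝ] E) =
        ((fderiv ℝ s x).comp (e.symm : E →L[ℝ] E)).smulRight (A (κ x)) := by
      ext; simp
    have e3 : (e.symm : E →L[ℝ] E) (A (κ x)) = κ x := by simp [← he]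
    rw [e2, traceL_smulRight, ContinuousLinearMap.comp_apply, e3, smul_eq_mul]
    ring

end Transform

/-! ### The Riccati inequality and its blow-up argument -/

section Riccati

variable {E : Type*} [NormedAddCommGroup E] [NormedSpace ℝ E] [FiniteDimensional ℝ E]

/-- The square of the divergence is controlled by the nonlinear term of Raychaudhuri's equation. -/
theorem IsRegularOn.sq_expansion_le {f : E × E → ℝ} {d : ℝ} {Ω : Set (E × E)}
    (h : IsRegularOn f d Ω) (hd : d ≠ 1) {κ : E → E} {x : E} (hκ : ContDiffAt ℝ ∞ κ x)
    (hz : (x, κ x) ∈ Ω) (hx : κ x ≠ 0) (hnull : ∀ᶠ y in 𝓝 x, f (y, κ y) = 0)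
    (hLor : IsLorentzian (fibreMetric f (x, κ x))) (hvert : vertD f (x, κ x) ≠ 0)
    (horth : ∀ X Y Z : E,
      vertD f (x, κ x) X *
          localContactD f (x, κ x) (Y, fderiv ℝ κ x Y) (Z, fderiv ℝ κ x Z) +
        vertD f (x, κ x) Y *
          localContactD f (x, κ x) (Z, fderiv ℝ κ x Z) (X, fderiv ℝ κ x X) +
        vertD f (x, κ x) Z *
          localContactD f (x, κ x) (X, fderiv ℝ κ x X) (Y, fderiv ℝ κ x Y) = 0)
    {r : ℝ} (hr : accel f (x, κ x) - fderiv ℝ κ x (κ x) = r • κ x) :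
    (traceL E (fieldEnd f κ x) + r) ^ 2 ≤ Module.finrank ℝ E *
      (traceL E ((fieldEnd f κ x).comp (fieldEnd f κ x)) - r ^ 2) := by
  have hd' : d - 1 ≠ 0 := sub_ne_zero.mpr hd
  have hsnd : ∀ b, fibreMetric f (x, κ x) b (κ x) = (d - 1) * vertD f (x, κ x) b :=
    fun b => h.fibreMetric_snd hz b
  have hq : ∀ b, fibreMetric f (x, κ x) b (κ x) = 0 ↔ vertD f (x, κ x) b = 0 := by
    intro b; rw [hsnd]; simp [hd']
  refine sq_screenTrace_le (fibreMetric f (x, κ x)) (fibreMetric_symm (h.contDiffAt hz)) hLor hx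
    ?_ (fieldEnd f κ x).toLinearMap r (h.fieldEnd_self hz hr) ?_ ?_
  · rw [hq]
    have := h.euler _ hz
    simp only at this
    rw [this, hnull.self_of_nhds, mul_zero]
  · intro X
    exact (hq _).2 (h.vertD_fieldEnd hκ hz hd hnull X)
  · intro X Y hX hY
    rw [hq] at hX hY
    -- With `X`, `Y` in the kernel of `α` and `α(Z) ≠ 0`, the identity `α ∧ dα = 0` reduces to
    -- `dα(X, Y) = 0`.
    obtain ⟨Z, hZ⟩ := DFunLike.ne_iff.mp hvert
    have h1 := horth X Y Z
    rw [hX, hY, zero_mul, zero_mul, zero_add, zero_add] at h1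
    have h2 := (mul_eq_zero.mp h1).resolve_left hZ
    rw [h.localContactD_field hz] at h2
    exact sub_eq_zero.mp h2

/-- The Riccati inequality for the divergence along a null geodesic, in coordinates. -/
theorem IsRegularOn.riccati {f : E × E → ℝ} {d : ℝ} {Ω : Set (E × E)}
    (h : IsRegularOn f d Ω) (hd : d ≠ 1) {κ : E → E} {x : E} (hκ : ContDiffAt ℝ ∞ κ x)
    (hz : (x, κ x) ∈ Ω) (hx : κ x ≠ 0) (hnull : ∀ᶠ y in 𝓝 x, f (y, κ y) = 0)
    (hLor : IsLorentzian (fibreMetric f (x, κ x))) (hvert : vertD f (x, κ x) ≠ 0)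
    (horth : ∀ X Y Z : E,
      vertD f (x, κ x) X *
          localContactD f (x, κ x) (Y, fderiv ℝ κ x Y) (Z, fderiv ℝ κ x Z) +
        vertD f (x, κ x) Y *
          localContactD f (x, κ x) (Z, fderiv ℝ κ x Z) (X, fderiv ℝ κ x X) +
        vertD f (x, κ x) Z *
          localContactD f (x, κ x) (X, fderiv ℝ κ x X) (Y, fderiv ℝ κ x Y) = 0)
    (henergy : traceL E (tidalEnd f (x, κ x)) ≤ 0)
    (hgeo : ∀ᶠ y in 𝓝 x, ∃ b, HasExpansion f κ y b)
    {γ : ℝ → E × E} {t₀ : ℝ} (hγ : HasDerivAt γ (localSpray f (x, κ x)) t₀)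
    (hγ₀ : γ t₀ = (x, κ x)) {μ θ : ℝ → ℝ}
    (hμ : ∀ᶠ t in 𝓝 t₀, μ t ≠ 0 ∧ κ (γ t).1 = μ t • (γ t).2)
    (hθ : ∀ᶠ t in 𝓝 t₀, HasExpansion f κ (γ t).1 (μ t * θ t)) :
    ∃ θ' : ℝ, HasDerivAt θ θ' t₀ ∧ θ t₀ ^ 2 ≤ Module.finrank ℝ E * (-θ') := by
  obtain ⟨r, hr⟩ : ∃ r : E → ℝ, ∀ᶠ y in 𝓝 x,
      accel f (y, κ y) - fderiv ℝ κ y (κ y) = r y • κ y := by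
    classical
    refine ⟨fun y => if hy : ∃ b, HasExpansion f κ y b then hy.choose_spec.choose else 0, ?_⟩
    filter_upwards [hgeo] with y hy
    simp only [hy, dif_pos]
    exact hy.choose_spec.choose_spec.1
  have hkd := hκ.differentiableAt (by simp)
  have hkd' := (contDiffAt_fderiv_of hκ).differentiableAt (by simp)
  have hud : DifferentiableAt ℝ (fun y => accel f (y, κ y)) x :=
    DifferentiableAt.comp (f := fun y => (y, κ y)) x
      ((h.accel_contDiffAt hz).differentiableAt (by simp)) (differentiableAt_id.prodMk hkd)
  have hrd : DifferentiableAt ℝ r x :=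
    differentiableAt_of_smul_eq (hud.sub (hkd'.clm_apply hkd)) hkd hx hr
  obtain ⟨β', hβ, hray⟩ := h.raychaudhuri hκ hz hrd hr
  have hsq := h.sq_expansion_le hd hκ hz hx hnull hLor hvert horth hr.self_of_nhds
  have hγ1 : HasDerivAt (fun t => (γ t).1) (κ x) t₀ := hγ.fst
  have hγ2 : HasDerivAt (fun t => (γ t).2) (accel f (x, κ x)) t₀ := hγ.snd
  have hγx : (γ t₀).1 = x := by rw [hγ₀]
  have hγk : (γ t₀).2 = κ x := by rw [hγ₀]
  have hμ0 : μ t₀ = 1 := by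
    have := hμ.self_of_nhds.2
    rw [hγx, hγk] at this
    have e : (1 : ℝ) • κ x = μ t₀ • κ x := by rw [one_smul]; exact this
    exact (smul_left_injective ℝ hx e).symm
  have hκγ : HasDerivAt (fun t => κ (γ t).1) (fderiv ℝ κ x (κ x)) t₀ := by
    have := hkd.hasFDerivAt
    rw [← hγx] at this
    have := this.comp_hasDerivAt t₀ hγ1
    rwa [hγx] at this
  have hμd : DifferentiableAt ℝ μ t₀ :=
    differentiableAt_of_smul_eq (a := fun t => κ (γ t).1) (w := fun t => (γ t).2)
      hκγ.differentiableAt hγ2.differentiableAt (by rw [hγk]; exact hx) (hμ.mono fun t ht => ht.2)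
  -- Differentiate `κ = μ γ̇` along the curve: the left side gives `Dκ κ = u - r κ`, the right side
  -- `μ' κ + u`. So the quotient rule for `β / μ` produces the term `r β` of Raychaudhuri's
  -- equation.
  have hμ' : deriv μ t₀ = -r x := by
    have e1 := (hμd.hasDerivAt.fun_smul hγ2).congr_of_eventuallyEq (hμ.mono fun t ht => ht.2)
    have e2 := hκγ.unique e1
    rw [hμ0, hγk, one_smul] at e2
    have e3 := hr.self_of_nhds
    rw [e2] at e3
    have e4 : deriv μ t₀ • κ x = (-r x) • κ x := by
      rw [neg_smul, ← e3]; abel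
    exact smul_left_injective ℝ hx e4
  set β : E → ℝ := fun y => traceL E (fieldEnd f κ y) + r y with hβdef
  have hβγ : HasDerivAt (fun t => β (γ t).1) (β' (κ x)) t₀ := by
    rw [← hγx] at hβ
    exact hβ.comp_hasDerivAt t₀ hγ1
  have hcont : Filter.Tendsto (fun t => (γ t).1) (𝓝 t₀) (𝓝 x) := by
    have := hγ1.continuousAt.tendsto
    rwa [hγx] at this
  have hkne : ∀ᶠ y in 𝓝 x, κ y ≠ 0 := hkd.continuousAt.eventually_ne hx
  have hθβ : ∀ᶠ t in 𝓝 t₀, θ t = β (γ t).1 / μ t := by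
    filter_upwards [hμ, hθ, hcont.eventually hr, hcont.eventually hkne] with t h1 h2 h3 h4
    have := h2.unique h4 ⟨r (γ t).1, h3, rfl⟩
    rw [eq_div_iff h1.1, mul_comm, this]
  have hθd := (hβγ.fun_div hμd.hasDerivAt hμ.self_of_nhds.1).congr_of_eventuallyEq hθβ
  refine ⟨_, hθd, ?_⟩
  have hθ0 : θ t₀ = β x := by rw [hθβ.self_of_nhds, hμ0, hγx, div_one]
  rw [hθ0, hμ0, hγx, hμ']
  have hn : (0 : ℝ) ≤ Module.finrank ℝ E := Nat.cast_nonneg _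
  refine hsq.trans (mul_le_mul_of_nonneg_left ?_ hn)
  have e : β x = traceL E (fieldEnd f κ x) + r x := rfl
  rw [← e] at hray
  linarith

/-- A solution of the Riccati inequality on a half-line is nonnegative. -/
theorem nonneg_of_riccati {J : Set ℝ} (hJ : IsUpperSet J) {c : ℝ} {θ θ' : ℝ → ℝ}
    (hθ : ∀ t ∈ J, HasDerivAt θ (θ' t) t) (hle : ∀ t ∈ J, θ t ^ 2 ≤ c * (-θ' t)) (hc : 0 < c)
    {t : ℝ} (ht : t ∈ J) : 0 ≤ θ t := by
  by_contra! hneg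
  have hmem : ∀ s ∈ Ici t, s ∈ J := fun s hs => hJ hs ht
  have hθ'0 : ∀ s ∈ J, θ' s ≤ 0 := by
    intro s hs
    have h1 := (sq_nonneg (θ s)).trans (hle s hs)
    have := nonneg_of_mul_nonneg_right h1 hc
    linarith
  have hanti : AntitoneOn θ (Ici t) := by
    refine antitoneOn_of_hasDerivWithinAt_nonpos (convex_Ici t)
      (fun s hs => (hθ s (hmem s hs)).continuousAt.continuousWithinAt)
      (fun s hs => (hθ s (hmem s (interior_subset hs))).hasDerivWithinAt)
      (fun s hs => hθ'0 s (hmem s (interior_subset hs)))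
  have hnegs : ∀ s ∈ Ici t, θ s < 0 := fun s hs =>
    (hanti self_mem_Ici hs hs).trans_lt hneg
  -- In terms of `1/θ` the inequality is linear: `1/θ` grows at rate at least `1/c`.
  have hd : ∀ s ∈ Ici t, HasDerivAt (fun s => (θ s)⁻¹ - s / c) (-θ' s / θ s ^ 2 - 1 / c) s :=
    fun s hs => ((hθ s (hmem s hs)).fun_inv (hnegs s hs).ne).sub ((hasDerivAt_id s).div_const c)
  have hmono : MonotoneOn (fun s => (θ s)⁻¹ - s / c) (Ici t) := by
    refine monotoneOn_of_hasDerivWithinAt_nonneg (convex_Ici t)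
      (fun s hs => (hd s hs).continuousAt.continuousWithinAt)
      (fun s hs => (hd s (interior_subset hs)).hasDerivWithinAt) (fun s hs => ?_)
    have hs' := interior_subset hs
    have h1 := hle s (hmem s hs')
    have h2 : 0 < θ s ^ 2 := sq_pos_of_neg (hnegs s hs')
    rw [sub_nonneg, div_le_div_iff₀ hc h2]
    linarith
  -- The time by which `1/θ`, starting from a negative value, must have reached zero.
  have hlarge : t ≤ t - c * (θ t)⁻¹ := by
    have := mul_neg_of_pos_of_neg hc (inv_lt_zero.mpr hneg)
    linarith
  have h1 := hmono self_mem_Ici (mem_Ici.mpr hlarge) hlarge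
  have h2 := inv_lt_zero.mpr (hnegs _ (mem_Ici.mpr hlarge))
  simp only at h1
  have h3 : (t - c * (θ t)⁻¹) / c = t / c - (θ t)⁻¹ := by field_simp
  rw [h3] at h1
  linarith

end Riccati

/-! ### Charts of the tangent bundle induced by charts of the base -/

section Charts

variable {n : ℕ} {M : Type*} [TopologicalSpace M] [ChartedSpace (Eu n) M]
  [IsManifold (𝓡 n) ∞ M]

/-- The chart of `M` at `y`. -/
abbrev baseChart (n : ℕ) {M : Type*} [TopologicalSpace M] [ChartedSpace (Eu n) M] (y : M) :
    PartialEquiv M (Eu n) := extChartAt (𝓡 n) y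

/-- The chart of `TM` induced by the chart of `M` at `y`. -/
abbrev tanChart (n : ℕ) {M : Type*} [TopologicalSpace M] [ChartedSpace (Eu n) M]
    [IsManifold (𝓡 n) ∞ M] (y : M) :
    PartialEquiv (TM n M) (Eu n × Eu n) := extChartAt (𝓡 n).tangent (⟨y, 0⟩ : TM n M)

theorem tanChart_apply (y : M) (p : TM n M) :
    tanChart n y p = (baseChart n y p.proj, tangentCoordChange (𝓡 n) p.proj y p.proj p.snd) := rfl

theorem mem_tanChart_source {y : M} {p : TM n M} :
    p ∈ (tanChart n y).source ↔ p.proj ∈ (baseChart n y).source := by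
  simp [tanChart, baseChart]

theorem mem_tanChart_target {y : M} {z : Eu n × Eu n} :
    z ∈ (tanChart n y).target ↔ z.1 ∈ (baseChart n y).target := by
  rw [tanChart, baseChart, extChartAt_target, extChartAt_target]
  simp only [ModelWithCorners.tangent, mfld_simps, Prod.map_id, range_id]
  exact TangentBundle.mem_chart_target_iff (I := 𝓡 n) z (⟨y, 0⟩ : TM n M)

theorem tanChart_scale (y : M) (t : ℝ) (p : TM n M) :
    tanChart n y (scale t p) = ((tanChart n y p).1, t • (tanChart n y p).2) := by
  rw [tanChart_apply, tanChart_apply]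
  refine Prod.ext rfl ?_
  exact map_smul (tangentCoordChange (𝓡 n) p.proj y p.proj) t p.snd

theorem tanChart_symm_smul {y : M} {ξ : Eu n} (hξ : ξ ∈ (baseChart n y).target) (t : ℝ)
    (v : Eu n) : (tanChart n y).symm (ξ, t • v) = scale t ((tanChart n y).symm (ξ, v)) := by
  have h1 : ((ξ, v) : Eu n × Eu n) ∈ (tanChart n y).target := mem_tanChart_target.2 hξ
  have h2 : scale t ((tanChart n y).symm (ξ, v)) ∈ (tanChart n y).source :=
    mem_tanChart_source.2 (mem_tanChart_source.1 ((tanChart n y).map_target h1))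
  rw [← (tanChart n y).left_inv h2, tanChart_scale, (tanChart n y).right_inv h1]

/-- The coordinate change between two charts of `M`. -/
def chartChange (n : ℕ) {M : Type*} [TopologicalSpace M] [ChartedSpace (Eu n) M] (y y' : M) :
    Eu n → Eu n := baseChart n y' ∘ (baseChart n y).symm

/-- The model has no boundary, so the derivative within the range in `tangentCoordChange` is an
ordinary derivative. -/
theorem fderiv_chartChange (y y' x : M) :
    fderiv ℝ (chartChange n y y') (baseChart n y x) = tangentCoordChange (𝓡 n) y y' x := by
  rw [tangentCoordChange_def]
  simp [chartChange, fderivWithin_univ]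

theorem tanChart_change {y y' : M} {p : TM n M} (hp : p.proj ∈ (baseChart n y).source)
    (hp' : p.proj ∈ (baseChart n y').source) :
    tanChart n y' p = (chartChange n y y' (tanChart n y p).1,
      fderiv ℝ (chartChange n y y') (tanChart n y p).1 (tanChart n y p).2) := by
  rw [tanChart_apply y]
  simp only
  rw [fderiv_chartChange]
  refine Prod.ext ?_ (tangentCoordChange_comp (I := 𝓡 n) (v := p.snd)
    ⟨⟨mem_extChartAt_source _, hp⟩, hp'⟩).symm
  simp only [chartChange, Function.comp_apply]
  rw [(baseChart n y).left_inv hp]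
  rfl

theorem contDiffAt_chartChange {y y' x : M} (hx : x ∈ (baseChart n y).source)
    (hx' : x ∈ (baseChart n y').source) :
    ContDiffAt ℝ ∞ (chartChange n y y') (baseChart n y x) := by
  have h := contDiffWithinAt_ext_coord_change (I := 𝓡 n) (n := ∞) y' y
    (y := baseChart n y x) (by
      rw [PartialEquiv.trans_source'', PartialEquiv.symm_symm, PartialEquiv.symm_target]
      exact mem_image_of_mem _ ⟨hx, hx'⟩)
  simpa [chartChange, contDiffWithinAt_univ] using h

theorem isInvertible_fderiv_chartChange {y y' x : M} (hx : x ∈ (baseChart n y).source)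
    (hx' : x ∈ (baseChart n y').source) :
    (fderiv ℝ (chartChange n y y') (baseChart n y x)).IsInvertible := by
  rw [fderiv_chartChange]
  refine ⟨ContinuousLinearEquiv.equivOfInverse (tangentCoordChange (𝓡 n) y y' x)
    (tangentCoordChange (𝓡 n) y' y x) (fun v => ?_) (fun v => ?_), rfl⟩
  · rw [tangentCoordChange_comp ⟨⟨hx, hx'⟩, hx⟩, tangentCoordChange_self hx]
  · rw [tangentCoordChange_comp ⟨⟨hx', hx⟩, hx'⟩, tangentCoordChange_self hx']

omit [IsManifold (𝓡 n) ∞ M] in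
theorem isOpen_baseChart_target (y : M) : IsOpen (baseChart n y).target :=
  isOpen_extChartAt_target y

omit [IsManifold (𝓡 n) ∞ M] in
theorem eventually_symm_mem_source {y y' x : M} (hx : x ∈ (baseChart n y).source)
    (hx' : x ∈ (baseChart n y').source) :
    ∀ᶠ ξ in 𝓝 (baseChart n y x), ξ ∈ (baseChart n y).target ∧
      (baseChart n y).symm ξ ∈ (baseChart n y').source := by
  have h1 : ContinuousAt (baseChart n y).symm (baseChart n y x) :=
    continuousAt_extChartAt_symm' hx
  refine Filter.Eventually.and ?_ (h1.eventually_mem ?_)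
  · exact (isOpen_baseChart_target y).mem_nhds ((baseChart n y).map_source hx)
  · rw [(baseChart n y).left_inv hx]
    exact (isOpen_extChartAt_source y').mem_nhds hx'

end Charts

/-! ### Defining functions in coordinates -/

section Regular

variable {n : ℕ} {M : Type*} [TopologicalSpace M] [ChartedSpace (Eu n) M]
  [IsManifold (𝓡 n) ∞ M] {𝒢 : Set (SM n M)} (L : DefiningFunction 𝒢)

namespace DefiningFunction

/-- The defining function, read in the chart of `TM` over the chart of `M` at `y`. -/
def localFn (y : M) (z : Eu n × Eu n) : ℝ := L.G ((tanChart n y).symm z)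

/-- The domain of `localFn`, where it is regular. -/
def region (y : M) : Set (Eu n × Eu n) :=
  {z | (z ∈ (tanChart n y).target ∧ (tanChart n y).symm z ∈ L.domain) ∧
    (fibreMetric (L.localFn y) z).IsInvertible}

theorem isOpen_preregion (y : M) :
    IsOpen {z | z ∈ (tanChart n y).target ∧ (tanChart n y).symm z ∈ L.domain} :=
  (continuousOn_extChartAt_symm (I := (𝓡 n).tangent) (⟨y, 0⟩ : TM n M)).isOpen_inter_preimage
    (isOpen_extChartAt_target _) L.isOpen_domain

theorem contDiffOn_local (y : M) : ContDiffOn ℝ ∞ (L.localFn y)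
    {z | z ∈ (tanChart n y).target ∧ (tanChart n y).symm z ∈ L.domain} := by
  rw [← contMDiffOn_iff_contDiffOn]
  have h1 := contMDiffOn_extChartAt_symm (I := (𝓡 n).tangent) (n := ∞) (⟨y, 0⟩ : TM n M)
  exact L.smooth.comp (s := {z | z ∈ (tanChart n y).target ∧ (tanChart n y).symm z ∈ L.domain})
    (h1.mono fun z hz => hz.1) fun z hz => hz.2

theorem local_smul {y : M} {z : Eu n × Eu n} (hz : z ∈ (tanChart n y).target)
    (hd : (tanChart n y).symm z ∈ L.domain) {t : ℝ} (ht : 0 < t) :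
    L.localFn y (z.1, t • z.2) = t ^ L.degree * L.localFn y z := by
  unfold localFn
  rw [tanChart_symm_smul (mem_tanChart_target.1 hz), L.homogeneous _ hd t ht]

/-- Openness holds because invertible maps form an open set, and Euler's relation is the derivative
of homogeneity at scale 1. -/
theorem isRegularOn (y : M) : IsRegularOn (L.localFn y) L.degree (L.region y) where
  isOpen := by
    rw [isOpen_iff_mem_nhds]
    rintro z ⟨hz, e, he⟩
    have h1 := (L.isOpen_preregion y).mem_nhds hz
    have h2 : ContinuousAt (fibreMetric (L.localFn y)) z :=
      (contDiffAt_fibreMetric ((L.contDiffOn_local y).contDiffAt h1)).continuousAt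
    have h3 : ∀ᶠ B in 𝓝 (fibreMetric (L.localFn y) z), B.IsInvertible := by
      have := e.nhds
      rw [he] at this
      exact this
    filter_upwards [h1, h2.eventually h3] with w hw hw'
    exact ⟨hw, hw'⟩
  smooth := (L.contDiffOn_local y).mono fun z hz => hz.1
  invertible z hz := hz.2
  euler := by
    rintro z ⟨hz, -⟩
    have h1 := (L.isOpen_preregion y).mem_nhds hz
    have h2 := (((L.contDiffOn_local y).contDiffAt h1).differentiableAt (by simp)).hasFDerivAt
    have h3 : HasDerivAt (fun t : ℝ => ((z.1, t • z.2) : Eu n × Eu n)) (0, z.2) 1 := by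
      have := (hasDerivAt_const (1 : ℝ) z.1).prodMk ((hasDerivAt_id (1 : ℝ)).smul_const z.2)
      simpa using this
    have h4 : HasDerivAt (fun t : ℝ => L.localFn y (z.1, t • z.2))
        (fderiv ℝ (L.localFn y) z (0, z.2)) 1 :=
      HasFDerivAt.comp_hasDerivAt (l := L.localFn y) (1 : ℝ) (by simpa using h2) h3
    have h5 : HasDerivAt (fun t : ℝ => t ^ L.degree * L.localFn y z)
        (L.degree * L.localFn y z) 1 := by
      have := ((Real.hasDerivAt_rpow_const (x := 1) (p := L.degree) (Or.inl one_ne_zero)).mul_const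
        (L.localFn y z))
      simpa using this
    refine h4.unique (h5.congr_of_eventuallyEq ?_)
    filter_upwards [lt_mem_nhds (zero_lt_one (α := ℝ))] with t ht
    exact L.local_smul hz.1 hz.2 ht

/-- Nondegeneracy of `L` is stated in the chart centred at each point, where it gives invertibility
by equality of dimensions. In other charts it is part of the definition of `region`, so no
transformation law of the metric is needed. -/
theorem coord_mem_region {p : TM n M} (hp : p ∈ L.domain) : coord p ∈ L.region p.proj := by
  have hs : p ∈ (tanChart n p.proj).source := mem_tanChart_source.2 (mem_extChartAt_source _)
  have hc : coord p = tanChart n p.proj p := rfl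
  refine ⟨⟨?_, ?_⟩, ?_⟩
  · rw [hc]; exact (tanChart n p.proj).map_source hs
  · rw [hc, (tanChart n p.proj).left_inv hs]; exact hp
  · have hinj : Function.Injective (fibreMetric (L.localFn p.proj) (coord p)) := by
      rw [injective_iff_map_eq_zero]
      intro a ha
      refine L.nondegenerate p hp a fun b => ?_
      change fibreMetric (L.localFn p.proj) (coord p) a b = 0
      rw [ha]; rfl
    have hrank : Module.finrank ℝ (Eu n) = Module.finrank ℝ (Eu n →L[ℝ] ℝ) := by
      rw [← LinearMap.toContinuousLinearMap.finrank_eq]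
      simp
    let e := LinearEquiv.ofInjectiveOfFinrankEq
      (fibreMetric (L.localFn p.proj) (coord p)).toLinearMap hinj hrank
    exact ⟨e.toContinuousLinearEquiv, by ext; rfl⟩

end DefiningFunction

end Regular

/-! ### Representatives of a section of rays, and invariance of the expansion -/

section Fields

variable {n : ℕ} {M : Type*} [TopologicalSpace M] [ChartedSpace (Eu n) M]
  [IsManifold (𝓡 n) ∞ M]

/-- The coordinate expression of a vector field in the chart at `y`. -/
def fieldRep (k : ∀ x : M, TangentSpace (𝓡 n) x) (y : M) (ξ : Eu n) : Eu n :=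
  (tanChart n y (graph k ((baseChart n y).symm ξ))).2

theorem tanChart_graph {k : ∀ x : M, TangentSpace (𝓡 n) x} {y : M} {ξ : Eu n}
    (hξ : ξ ∈ (baseChart n y).target) :
    tanChart n y (graph k ((baseChart n y).symm ξ)) = (ξ, fieldRep k y ξ) :=
  Prod.ext ((baseChart n y).right_inv hξ) rfl

theorem tanChart_graph' {k : ∀ x : M, TangentSpace (𝓡 n) x} {y x : M}
    (hx : x ∈ (baseChart n y).source) :
    tanChart n y (graph k x) = (baseChart n y x, fieldRep k y (baseChart n y x)) := by
  rw [← tanChart_graph ((baseChart n y).map_source hx), (baseChart n y).left_inv hx]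

theorem tanChart_symm_field {k : ∀ x : M, TangentSpace (𝓡 n) x} {y : M} {ξ : Eu n}
    (hξ : ξ ∈ (baseChart n y).target) :
    (tanChart n y).symm (ξ, fieldRep k y ξ) = graph k ((baseChart n y).symm ξ) := by
  rw [← tanChart_graph hξ]
  exact (tanChart n y).left_inv (mem_tanChart_source.2 ((baseChart n y).map_target hξ))

omit [IsManifold (𝓡 n) ∞ M] in
theorem eventually_symm_mem {y x : M} (hx : x ∈ (baseChart n y).source) {W : Set M}
    (hW : W ∈ 𝓝 x) : ∀ᶠ ξ in 𝓝 (baseChart n y x), (baseChart n y).symm ξ ∈ W := by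
  have h1 : ContinuousAt (baseChart n y).symm (baseChart n y x) :=
    continuousAt_extChartAt_symm' hx
  refine h1.eventually_mem ?_
  rwa [(baseChart n y).left_inv hx]

omit [IsManifold (𝓡 n) ∞ M] in
theorem eventually_mem_target {y x : M} (hx : x ∈ (baseChart n y).source) :
    ∀ᶠ ξ in 𝓝 (baseChart n y x), ξ ∈ (baseChart n y).target :=
  (isOpen_baseChart_target y).mem_nhds ((baseChart n y).map_source hx)

variable {s : M → SM n M} {W : Set M} {k : ∀ x : M, TangentSpace (𝓡 n) x}

theorem IsRepresentative.contMDiffAt (hk : IsRepresentative s W k) {x : M} (hx : x ∈ W) :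
    ContMDiffAt (𝓡 n) (𝓡 n).tangent ∞ (graph k) x :=
  hk.smooth.contMDiffAt (hk.isOpen.mem_nhds hx)

theorem IsRepresentative.contDiffAt (hk : IsRepresentative s W k) {x y : M} (hx : x ∈ W)
    (hy : x ∈ (baseChart n y).source) : ContDiffAt ℝ ∞ (fieldRep k y) (baseChart n y x) := by
  have h1 : ContMDiffAt 𝓘(ℝ, Eu n) (𝓡 n) ∞ (baseChart n y).symm (baseChart n y x) :=
    (contMDiffOn_extChartAt_symm (I := 𝓡 n) (n := ∞) y).contMDiffAt
      ((isOpen_baseChart_target y).mem_nhds ((baseChart n y).map_source hy))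
  have h2 := hk.contMDiffAt hx
  have h3 : ContMDiffAt (𝓡 n).tangent 𝓘(ℝ, Eu n × Eu n) ∞ (tanChart n y) (graph k x) :=
    contMDiffAt_extChartAt' (I := (𝓡 n).tangent) (n := ∞) (by
      have := mem_tanChart_source.2 (show (graph k x).proj ∈ (baseChart n y).source from hy)
      rwa [tanChart, extChartAt_source] at this)
  have h4 : ContMDiffAt (𝓡 n) 𝓘(ℝ, Eu n × Eu n) ∞ (fun x => tanChart n y (graph k x)) x :=
    ContMDiffAt.comp x h3 h2
  have h5 : ContMDiffAt 𝓘(ℝ, Eu n) 𝓘(ℝ, Eu n × Eu n) ∞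
      (fun ξ => tanChart n y (graph k ((baseChart n y).symm ξ))) (baseChart n y x) :=
    ContMDiffAt.comp (g := fun x => tanChart n y (graph k x)) (f := (baseChart n y).symm)
      (baseChart n y x) (by rwa [(baseChart n y).left_inv hy]) h1
  exact (contMDiffAt_iff_contDiffAt.1 h5).snd

theorem IsRepresentative.ne_zero (hk : IsRepresentative s W k) {x : M} (hx : x ∈ W) : k x ≠ 0 :=
  (hk.spans x hx).1

omit [IsManifold (𝓡 n) ∞ M] in
theorem scale_graph_inj {k k' : ∀ x : M, TangentSpace (𝓡 n) x} {x : M} {t : ℝ} :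
    scale t (graph k x) = graph k' x ↔ k' x = t • k x := by
  constructor
  · intro h
    have := TotalSpace.mk_inj.1 (h : (⟨x, t • k x⟩ : TM n M) = ⟨x, k' x⟩)
    exact this.symm
  · intro h
    have : (⟨x, t • k x⟩ : TM n M) = ⟨x, k' x⟩ := by rw [h]
    exact this

omit [IsManifold (𝓡 n) ∞ M] in
theorem exists_smul_of_ray_eq {p q : TM n M} {hp : p.snd ≠ 0} {hq : q.snd ≠ 0}
    (h : ray ⟨p, hp⟩ = ray ⟨q, hq⟩) : ∃ t : ℝ, 0 < t ∧ scale t p = q :=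
  Quotient.exact (s := raySetoid n M) h

omit [IsManifold (𝓡 n) ∞ M] in
theorem ray_scale {p : TM n M} (hp : p.snd ≠ 0) {t : ℝ} (ht : 0 < t) (hp' : (scale t p).snd ≠ 0) :
    ray ⟨scale t p, hp'⟩ = ray ⟨p, hp⟩ :=
  (Quotient.sound (s := raySetoid n M) ⟨t, ht, rfl⟩).symm

omit [IsManifold (𝓡 n) ∞ M] in
theorem scale_mem_cone {A : Set (SM n M)} {p : TM n M} (hp : p ∈ cone A) {t : ℝ} (ht : 0 < t) :
    scale t p ∈ cone A := by
  obtain ⟨h0, hA⟩ := hp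
  have h1 : (scale t p).snd ≠ 0 := smul_ne_zero ht.ne' h0
  exact ⟨h1, by rwa [ray_scale h0 ht h1]⟩

theorem IsRepresentative.exists_smul (hk : IsRepresentative s W k) {W' : Set M}
    {k' : ∀ x : M, TangentSpace (𝓡 n) x} (hk' : IsRepresentative s W' k') {x : M} (hx : x ∈ W)
    (hx' : x ∈ W') : ∃ t : ℝ, 0 < t ∧ k' x = t • k x := by
  obtain ⟨h1, h2⟩ := hk.spans x hx
  obtain ⟨h1', h2'⟩ := hk'.spans x hx'
  obtain ⟨t, ht, h⟩ := exists_smul_of_ray_eq (h2.trans h2'.symm)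
  exact ⟨t, ht, scale_graph_inj.1 h⟩

theorem fieldRep_change {k k' : ∀ x : M, TangentSpace (𝓡 n) x} {y y' x : M} {t : ℝ}
    (hy : x ∈ (baseChart n y).source) (hy' : x ∈ (baseChart n y').source) (h : k' x = t • k x) :
    fieldRep k' y' (baseChart n y' x) = t • fderiv ℝ (chartChange n y y') (baseChart n y x)
      (fieldRep k y (baseChart n y x)) := by
  have h1 := tanChart_change (p := graph k x) hy hy'
  rw [tanChart_graph' hy] at h1
  have h2 := tanChart_scale y' t (graph k x)
  rw [scale_graph_inj.2 h, tanChart_graph' hy', h1] at h2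
  exact congrArg Prod.snd h2

theorem fieldRep_ne_zero {k : ∀ x : M, TangentSpace (𝓡 n) x} {y x : M}
    (hy : x ∈ (baseChart n y).source) (h : k x ≠ 0) : fieldRep k y (baseChart n y x) ≠ 0 := by
  intro h0
  apply h
  have h2 := tanChart_scale y 0 (graph k x)
  rw [tanChart_graph' hy, h0, smul_zero] at h2
  have h3 : tanChart n y (graph k x) = tanChart n y (scale 0 (graph k x)) := by
    rw [h2, tanChart_graph' hy, h0]
  have h4 := (tanChart n y).injOn (mem_tanChart_source.2 (show (graph k x).proj ∈ _ from hy))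
    (mem_tanChart_source.2 (show (scale 0 (graph k x)).proj ∈ _ from hy)) h3
  have := scale_graph_inj.1 h4.symm
  rwa [zero_smul] at this

variable {𝒢 : Set (SM n M)} (L : DefiningFunction 𝒢)

/-- Expansions computed in different charts and from different representatives agree, up to the
scaling of the representatives. -/
theorem expansion_change {W' : Set M} {k' : ∀ x : M, TangentSpace (𝓡 n) x}
    (hk : IsRepresentative s W k) (hk' : IsRepresentative s W' k') {x y y' : M} (hx : x ∈ W)
    (hx' : x ∈ W') (hy : x ∈ (baseChart n y).source) (hy' : x ∈ (baseChart n y').source)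
    (hreg : tanChart n y (graph k x) ∈ L.region y)
    (hreg' : tanChart n y' (graph k' x) ∈ L.region y') {t b : ℝ} (ht : 0 < t)
    (hkt : k' x = t • k x)
    (hb : HasExpansion (L.localFn y) (fieldRep k y) (baseChart n y x) b) :
    HasExpansion (L.localFn y') (fieldRep k' y') (baseChart n y' x) (t * b) := by
  set ξ := baseChart n y x with hξ
  set φ := chartChange n y y' with hφ
  have hφξ : φ ξ = baseChart n y' x := by
    simp only [hφ, hξ, chartChange, Function.comp_apply]
    rw [(baseChart n y).left_inv hy]
  -- The ratio of two representatives, chosen pointwise; its differentiability is recovered inside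
  -- `HasExpansion.transport`.
  obtain ⟨σ, hσ⟩ : ∃ σ : Eu n → ℝ, ∀ᶠ ζ in 𝓝 ξ,
      k' ((baseChart n y).symm ζ) = σ ζ • k ((baseChart n y).symm ζ) := by
    classical
    refine ⟨fun ζ => if h : ∃ t : ℝ, 0 < t ∧
      k' ((baseChart n y).symm ζ) = t • k ((baseChart n y).symm ζ) then h.choose else 0, ?_⟩
    filter_upwards [eventually_symm_mem hy (hk.isOpen.mem_nhds hx),
      eventually_symm_mem hy (hk'.isOpen.mem_nhds hx')] with ζ h1 h2
    have h := hk.exists_smul hk' h1 h2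
    simp only [h, dif_pos]
    exact h.choose_spec.2
  have hσξ : σ ξ = t := by
    have h1 := hσ.self_of_nhds
    rw [hξ, (baseChart n y).left_inv hy, hkt] at h1
    exact (smul_left_injective ℝ (hk.ne_zero hx) h1).symm
  have hsrc := eventually_symm_mem_source (n := n) hy hy'
  have hφd : ∀ᶠ ζ in 𝓝 ξ, ContDiffAt ℝ ∞ φ ζ := by
    filter_upwards [hsrc] with ζ hζ
    have := contDiffAt_chartChange ((baseChart n y).map_target hζ.1) hζ.2
    rwa [(baseChart n y).right_inv hζ.1] at this
  have hinv := isInvertible_fderiv_chartChange hy hy'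
  have hR := L.isRegularOn y
  have hR' := L.isRegularOn y'
  rw [tanChart_graph' hy] at hreg
  rw [tanChart_graph' hy'] at hreg'
  have hch := fieldRep_change hy hy' hkt
  have hlift : tangentLift φ t (ξ, fieldRep k y ξ) =
      (baseChart n y' x, fieldRep k' y' (baseChart n y' x)) := by
    rw [hch, ← hφξ]; rfl
  have key : HasExpansion (L.localFn y') (fieldRep k' y') (φ ξ) (σ ξ * b) := by
    refine hb.transport (fieldRep_ne_zero hy (hk.ne_zero hx)) (by rw [hσξ]; exact ht.ne')
      hφd.self_of_nhds hinv ((hk.contDiffAt hx hy).differentiableAt (by simp)) ?_ ?_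
      ((hR.accel_contDiffAt hreg).differentiableAt (by simp)) ?_ ?_
    · rw [hφξ]; exact (hk'.contDiffAt hx' hy').differentiableAt (by simp)
    · filter_upwards [hσ, hsrc] with ζ h1 h2
      have := fieldRep_change ((baseChart n y).map_target h2.1) h2.2 h1
      rwa [(baseChart n y).right_inv h2.1] at this
    · rw [hφξ]; exact (hR'.accel_contDiffAt hreg').differentiableAt (by simp)
    · rw [hσξ]
      have c1 : ContinuousAt (fun v : Eu n => (ξ, v)) (fieldRep k y ξ) := by fun_prop
      obtain ⟨LΦ, hLΦ, -⟩ := hasFDerivAt_tangentLift (z := (ξ, fieldRep k y ξ)) hφd.self_of_nhds t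
      have c2 : ∀ᶠ z in 𝓝 ((ξ, fieldRep k y ξ) : Eu n × Eu n), tangentLift φ t z ∈ L.region y' :=
        hLΦ.continuousAt.eventually_mem (by rw [hlift]; exact hR'.mem_nhds hreg')
      filter_upwards [c1.eventually_mem (hR.mem_nhds hreg), c1.eventually c2] with v hv hv'
      obtain ⟨e, he⟩ := hinv
      -- Homogeneity supplies the constant: the fibres are rescaled by the fixed `t = σ ξ`, not by
      -- the varying ratio.
      refine accel_tangentLift (c := t ^ L.degree) hR hR' hv hv' hφd
        (by intro w; exact ⟨e.symm w, by rw [← hφ, ← hξ] at he; simp [← he]⟩) ?_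
      have c3 : ∀ᶠ z : Eu n × Eu n in 𝓝 (ξ, v), z.1 ∈ (baseChart n y).target ∧
        (baseChart n y).symm z.1 ∈ (baseChart n y').source :=
        (continuous_fst.tendsto ((ξ, v) : Eu n × Eu n)).eventually hsrc
      filter_upwards [hR.mem_nhds hv, c3] with z hz hz3
      set p := (tanChart n y).symm z with hp
      have hpp : p.proj = (baseChart n y).symm z.1 := rfl
      have e1 : tangentLift φ t z = tanChart n y' (scale t p) := by
        have h1 := tanChart_change (p := p) (by rw [hpp]; exact (baseChart n y).map_target hz3.1)
          (by rw [hpp]; exact hz3.2 : p.proj ∈ (baseChart n y').source)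
        rw [tanChart_scale, h1, hp, (tanChart n y).right_inv hz.1.1]
        rfl
      have e2 : L.localFn y' (tangentLift φ t z) = L.G (scale t p) := by
        unfold DefiningFunction.localFn
        rw [e1, (tanChart n y').left_inv]
        exact mem_tanChart_source.2 hz3.2
      rw [e2, L.homogeneous p hz.1.2 t ht]
      rfl
  rwa [hφξ, hσξ] at key

end Fields

/-! ### Tangency to the cone over a Sachs manifold -/

section Tangency

variable {n : ℕ} {M : Type*} [TopologicalSpace M] [ChartedSpace (Eu n) M]
  [IsManifold (𝓡 n) ∞ M]

theorem mfderiv_tangent_eq {V : Type*} [NormedAddCommGroup V] [NormedSpace ℝ V]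
    {F : TM n M → V} {p : TM n M} (hF : MDifferentiableAt (𝓡 n).tangent 𝓘(ℝ, V) F p) :
    mfderiv (𝓡 n).tangent 𝓘(ℝ, V) F p =
      (fderiv ℝ (fun z => F ((tanChart n p.proj).symm z)) (coord p) : Eu n × Eu n →L[ℝ] V) := by
  rw [hF.mfderiv, ModelWithCorners.range_eq_univ, fderivWithin_univ]
  rfl

theorem differentiableAt_chart {V : Type*} [NormedAddCommGroup V] [NormedSpace ℝ V]
    {F : TM n M → V} {p : TM n M} (hF : MDifferentiableAt (𝓡 n).tangent 𝓘(ℝ, V) F p) :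
    DifferentiableAt ℝ (fun z => F ((tanChart n p.proj).symm z)) (coord p) := by
  have := hF.differentiableWithinAt_writtenInExtChartAt
  rw [ModelWithCorners.range_eq_univ, differentiableWithinAt_univ] at this
  exact this

theorem coord_graph (k : ∀ x : M, TangentSpace (𝓡 n) x) (x : M) :
    coord (graph k x) = (baseChart n x x, fieldRep k x (baseChart n x x)) :=
  tanChart_graph' (mem_extChartAt_source x)

omit [IsManifold (𝓡 n) ∞ M] in
theorem eventually_target (x : M) : ∀ᶠ ξ in 𝓝 (baseChart n x x), ξ ∈ (baseChart n x).target :=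
  eventually_mem_target (mem_extChartAt_source x)

variable {s : M → SM n M} {W : Set M} {k : ∀ x : M, TangentSpace (𝓡 n) x}

theorem IsRepresentative.hasFDerivAt (hk : IsRepresentative s W k) {x : M} (hx : x ∈ W) :
    HasFDerivAt (fun ξ => (ξ, fieldRep k x ξ)) ((ContinuousLinearMap.id ℝ (Eu n)).prod
      (fderiv ℝ (fieldRep k x) (baseChart n x x))) (baseChart n x x) :=
  (hasFDerivAt_id _).prodMk
    ((hk.contDiffAt hx (mem_extChartAt_source x)).differentiableAt (by simp)).hasFDerivAt

theorem pushforward_apply (hk : IsRepresentative s W k) {x : M} (hx : x ∈ W) (X : Eu n) :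
    pushforward k x X =
      ((X, fderiv ℝ (fieldRep k x) (baseChart n x x) X) : Eu n × Eu n) := by
  have hd := (hk.contMDiffAt hx).mdifferentiableAt (by simp)
  have h1 : pushforward k x = (fderiv ℝ (fun ξ => tanChart n x (graph k ((baseChart n x).symm ξ)))
      (baseChart n x x) : Eu n →L[ℝ] Eu n × Eu n) := by
    unfold pushforward
    rw [hd.mfderiv, ModelWithCorners.range_eq_univ, fderivWithin_univ]
    rfl
  have h2 : (fun ξ => tanChart n x (graph k ((baseChart n x).symm ξ))) =ᶠ[𝓝 (baseChart n x x)]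
      fun ξ => (ξ, fieldRep k x ξ) := by
    filter_upwards [eventually_target x] with ξ hξ
    exact tanChart_graph hξ
  rw [h1, h2.fderiv_eq, (hk.hasFDerivAt hx).fderiv]
  rfl

/-- The derivative of a function that vanishes along a section kills the push-forwards. -/
theorem fderiv_section_eq_zero {V : Type*} [NormedAddCommGroup V] [NormedSpace ℝ V]
    (hk : IsRepresentative s W k) {x : M} (hx : x ∈ W) {F : TM n M → V}
    (hF : MDifferentiableAt (𝓡 n).tangent 𝓘(ℝ, V) F (graph k x))
    (h0 : ∀ᶠ y in 𝓝 x, F (graph k y) = 0) (X : Eu n) :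
    fderiv ℝ (fun z => F ((tanChart n x).symm z)) (coord (graph k x))
      (X, fderiv ℝ (fieldRep k x) (baseChart n x x) X) = 0 := by
  have h1 := (differentiableAt_chart hF).hasFDerivAt
  rw [coord_graph] at h1 ⊢
  have h2 : HasFDerivAt (fun ξ => F ((tanChart n x).symm (ξ, fieldRep k x ξ))) _
      (baseChart n x x) :=
    HasFDerivAt.comp (g := fun z => F ((tanChart n x).symm z))
      (f := fun ξ => (ξ, fieldRep k x ξ)) (baseChart n x x) h1 (hk.hasFDerivAt hx)
  have h3 : (fun ξ => F ((tanChart n x).symm (ξ, fieldRep k x ξ))) =ᶠ[𝓝 (baseChart n x x)]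
      fun _ => 0 := by
    filter_upwards [eventually_target x,
      eventually_symm_mem (n := n) (mem_extChartAt_source x) h0] with ξ h4 h5
    rw [tanChart_symm_field h4]
    exact h5
  have h4 := DFunLike.congr_fun (h2.unique ((hasFDerivAt_const 0 _).congr_of_eventuallyEq h3)) X
  exact h4

variable {𝒢 𝒮 : Set (SM n M)} {N : Set M}

theorem graph_mem_cone (hs : IsSmoothSection 𝒮 N s) (hk : IsRepresentative s W k) {x : M}
    (hx : x ∈ W) (hxN : x ∈ N) : graph k x ∈ cone 𝒮 := by
  obtain ⟨h1, h2⟩ := hk.spans x hx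
  exact ⟨h1, by rw [h2]; exact hs.mem x hxN⟩

theorem eventually_graph_mem_cone (hs : IsSmoothSection 𝒮 N s) (hk : IsRepresentative s W k)
    {x : M} (hx : x ∈ W) (hxN : x ∈ N) : ∀ᶠ y in 𝓝 x, graph k y ∈ cone 𝒮 := by
  filter_upwards [hk.isOpen.mem_nhds hx, hs.isOpen.mem_nhds hxN] with y h1 h2
  exact graph_mem_cone hs hk h1 h2

/-- The section takes values in the cone, so a function vanishing on the cone near the point
vanishes along the section. -/
theorem isTangentTo_pushforward (hs : IsSmoothSection 𝒮 N s) (hk : IsRepresentative s W k)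
    {x : M} (hx : x ∈ W) (hxN : x ∈ N) (X : Eu n) :
    IsTangentTo (cone 𝒮) (graph k x) (pushforward k x X) := by
  intro f hf hf0
  have hfd := hf.mdifferentiableAt (by simp)
  rw [mfderiv_tangent_eq hfd, pushforward_apply hk hx]
  refine fderiv_section_eq_zero hk hx hfd ?_ X
  have hc : ContinuousAt (graph k) x := (hk.contMDiffAt hx).continuousAt
  filter_upwards [hc.eventually hf0, eventually_graph_mem_cone hs hk hx hxN] with y h1 h2
  exact h1 h2

/-- The congruence of a Sachs manifold is geodesic. -/
theorem exists_hasExpansion (hn : 1 ≤ n) (L : DefiningFunction 𝒢) (h𝒮 : IsSachsManifold 𝒢 𝒮)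
    (hs : IsSmoothSection 𝒮 N s) (hk : IsRepresentative s W k)
    {x : M} (hx : x ∈ W) (hxN : x ∈ N) (hdom : graph k x ∈ L.domain) :
    ∃ b, HasExpansion (L.localFn x) (fieldRep k x) (baseChart n x x) b := by
  set p := graph k x with hp
  have hpc : p ∈ cone 𝒮 := graph_mem_cone hs hk hx hxN
  obtain ⟨W₀, F, hW₀, hpW₀, hF, hsurj, hzero⟩ := h𝒮.isSubmanifold p hpc
  have hFat : ContMDiffAt (𝓡 n).tangent 𝓘(ℝ, Eu (n - 1)) ∞ F p :=
    hF.contMDiffAt (hW₀.mem_nhds hpW₀)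
  have hFd := hFat.mdifferentiableAt (by simp)
  set ξ := baseChart n x x with hξ
  set κ := fieldRep k x with hκ
  have hcoord : coord p = (ξ, κ ξ) := coord_graph k x
  set ψ : Eu n × Eu n → Eu (n - 1) := fun z => F ((tanChart n x).symm z) with hψ
  set D : Eu n × Eu n →L[ℝ] Eu (n - 1) := fderiv ℝ ψ (coord p) with hD
  have hDsurj : Function.Surjective D := by
    have := hsurj p hpW₀
    rw [mfderiv_tangent_eq hFd] at this
    exact this
  have hψd : HasFDerivAt ψ D (coord p) := (differentiableAt_chart hFd).hasFDerivAt
  have hvan : ∀ᶠ q in 𝓝 p, q ∈ cone 𝒮 → F q = 0 := by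
    filter_upwards [hW₀.mem_nhds hpW₀] with q hq hqc
    exact (hzero q hq).1 hqc
  have hc : ContinuousAt (graph k) x := (hk.contMDiffAt hx).continuousAt
  have h1 : ∀ X, D (X, fderiv ℝ κ ξ X) = 0 := by
    refine fderiv_section_eq_zero hk hx hFd ?_
    filter_upwards [hc.eventually hvan, eventually_graph_mem_cone hs hk hx hxN] with y h1 h2
    exact h1 h2
  -- The cone is invariant under positive scaling, so the curve `t ↦ t p` stays in it and its
  -- velocity at `t = 1` is tangent.
  have h2 : D (0, κ ξ) = 0 := by
    have e1 : HasDerivAt (fun t : ℝ => ((ξ, t • κ ξ) : Eu n × Eu n)) (0, κ ξ) 1 := by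
      have := (hasDerivAt_const (1 : ℝ) ξ).prodMk ((hasDerivAt_id (1 : ℝ)).smul_const (κ ξ))
      simpa using this
    have e2 : HasDerivAt (fun t : ℝ => ψ (ξ, t • κ ξ)) (D (0, κ ξ)) 1 :=
      HasFDerivAt.comp_hasDerivAt (l := ψ) (1 : ℝ) (by rw [one_smul, ← hcoord]; exact hψd) e1
    have hξt : ξ ∈ (baseChart n x).target := (eventually_target x).self_of_nhds
    have e3 : ∀ t : ℝ, (tanChart n x).symm (ξ, t • κ ξ) = scale t p := by
      intro t
      rw [tanChart_symm_smul hξt, tanChart_symm_field hξt, hξ,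
        (baseChart n x).left_inv (mem_extChartAt_source x)]
    have e4 : ContinuousAt (fun t : ℝ => scale t p) 1 := by
      have c1 : ContinuousAt (tanChart n x).symm (ξ, (1 : ℝ) • κ ξ) :=
        (continuousOn_extChartAt_symm (I := (𝓡 n).tangent) (⟨x, 0⟩ : TM n M)).continuousAt
          ((isOpen_extChartAt_target _).mem_nhds (mem_tanChart_target.2 hξt))
      have c2 : ContinuousAt (fun t : ℝ => (tanChart n x).symm (ξ, t • κ ξ)) 1 :=
        ContinuousAt.comp (f := fun t : ℝ => ((ξ, t • κ ξ) : Eu n × Eu n)) c1 e1.continuousAt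
      simpa only [e3] using c2
    have e5 : (fun t : ℝ => ψ (ξ, t • κ ξ)) =ᶠ[𝓝 1] fun _ => 0 := by
      have hone : scale (1 : ℝ) p = p := by simp [scale]
      have e6 : Filter.Tendsto (fun t : ℝ => scale t p) (𝓝 1) (𝓝 p) := by
        have := e4.tendsto
        rwa [hone] at this
      filter_upwards [lt_mem_nhds (zero_lt_one (α := ℝ)), e6.eventually hvan] with t ht ht2
      simp only [hψ, e3]
      exact ht2 (scale_mem_cone hpc ht)
    exact e2.unique ((hasDerivAt_const (1 : ℝ) (0 : Eu (n - 1))).congr_of_eventuallyEq e5)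
  -- Tangency of the spray is tested on real functions, hence the components of `F` one at a time.
  have h3 : D (localSpray (L.localFn x) (coord p)) = 0 := by
    ext i
    have ht := h𝒮.ruled L p hdom hpc (fun q => F q i)
      (by
        have := (EuclideanSpace.proj (𝕜 := ℝ) i : Eu (n - 1) →L[ℝ] ℝ).contDiff (n := ∞)
        exact this.contMDiff.contMDiffAt.comp p hFat)
      (by
        filter_upwards [hvan] with q hq hqc
        rw [hq hqc]; rfl)
    have hd : MDifferentiableAt (𝓡 n).tangent 𝓘(ℝ, ℝ) (fun q => F q i) p := by
      have := (EuclideanSpace.proj (𝕜 := ℝ) i : Eu (n - 1) →L[ℝ] ℝ).contDiff (n := ∞)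
      exact (this.contMDiff.contMDiffAt.comp p hFat).mdifferentiableAt (by simp)
    rw [mfderiv_tangent_eq hd] at ht
    have e1 : HasFDerivAt (fun z => ψ z i)
        ((EuclideanSpace.proj (𝕜 := ℝ) i : Eu (n - 1) →L[ℝ] ℝ).comp D) (coord p) :=
      (EuclideanSpace.proj (𝕜 := ℝ) i : Eu (n - 1) →L[ℝ] ℝ).hasFDerivAt.comp (coord p) hψd
    have e2 : fderiv ℝ (fun z => F ((tanChart n p.proj).symm z) i) (coord p) = _ := e1.fderiv
    rw [e2] at ht
    exact ht
  have hκ0 : κ ξ ≠ 0 := fieldRep_ne_zero (mem_extChartAt_source x) (hk.ne_zero hx)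
  -- Parametrizes the candidate tangent space by push-forwards and the radial direction; a preimage
  -- of the spray has the pregeodesic factor as its second component.
  let T : Eu n × ℝ →ₗ[ℝ] Eu n × Eu n :=
    (LinearMap.fst ℝ (Eu n) ℝ).prod
      ((fderiv ℝ κ ξ).toLinearMap ∘ₗ LinearMap.fst ℝ (Eu n) ℝ +
        (LinearMap.snd ℝ (Eu n) ℝ).smulRight (κ ξ))
  have hT : ∀ X (r : ℝ), T (X, r) = (X, fderiv ℝ κ ξ X + r • κ ξ) := fun X r => rfl
  have hTinj : Function.Injective T := by
    rw [injective_iff_map_eq_zero]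
    rintro ⟨X, r⟩ h
    rw [hT, Prod.mk_eq_zero] at h
    obtain ⟨rfl, h⟩ := h
    rw [map_zero, zero_add, smul_eq_zero] at h
    rw [h.resolve_right hκ0]; rfl
  have hle : LinearMap.range T ≤ LinearMap.ker D.toLinearMap := by
    rintro _ ⟨⟨X, r⟩, rfl⟩
    rw [LinearMap.mem_ker, hT]
    have e : ((X, fderiv ℝ κ ξ X + r • κ ξ) : Eu n × Eu n) =
      (X, fderiv ℝ κ ξ X) + r • (0, κ ξ) := by simp
    change D _ = 0
    rw [e, map_add, map_smul, h1, h2]; simp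
  -- Both spaces have dimension `n + 1 = 2n - (n - 1)`; `1 ≤ n` keeps the truncated subtraction
  -- exact.
  have hrange : LinearMap.range T = LinearMap.ker D.toLinearMap := by
    apply Submodule.eq_of_le_of_finrank_eq hle
    have r1 := LinearMap.finrank_range_of_inj hTinj
    have r2 := LinearMap.finrank_range_add_finrank_ker D.toLinearMap
    have r3 : LinearMap.range D.toLinearMap = ⊤ := LinearMap.range_eq_top.2 hDsurj
    rw [r3, finrank_top] at r2
    simp only [Module.finrank_prod, finrank_euclideanSpace, Fintype.card_fin,
      Module.finrank_self] at r1 r2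
    omega
  have hmem : localSpray (L.localFn x) (coord p) ∈ LinearMap.range T := by
    rw [hrange]; exact h3
  obtain ⟨⟨X, r⟩, hXr⟩ := hmem
  rw [hT, hcoord] at hXr
  obtain ⟨hX, hu⟩ := Prod.mk.inj hXr
  refine ⟨_, r, ?_, rfl⟩
  rw [← hu]
  simp only at hX
  rw [hX]; abel

theorem IsRepresentative.const_smul (hk : IsRepresentative s W k) {a : ℝ} (ha : 0 < a) :
    IsRepresentative s W (fun x => a • k x) where
  isOpen := hk.isOpen
  smooth := by
    have := ContMDiffOn.const_smul_section (I := 𝓡 n) (F := Eu n)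
      (V := fun x : M => TangentSpace (𝓡 n) x) (a := a) (s := k) hk.smooth
    exact this
  spans x hx := by
    obtain ⟨h1, h2⟩ := hk.spans x hx
    have h3 : a • k x ≠ 0 := smul_ne_zero ha.ne' h1
    refine ⟨h3, ?_⟩
    rw [← h2]
    exact ray_scale (p := graph k x) h1 ha h3

end Tangency

/-! ### The normalized divergence along the geodesic -/

section Main

variable {n : ℕ} {M : Type*} [TopologicalSpace M] [ChartedSpace (Eu n) M]
  [IsManifold (𝓡 n) ∞ M] {𝒢 𝒮 : Set (SM n M)} {s : M → SM n M} {W N : Set M}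
  {k : ∀ x : M, TangentSpace (𝓡 n) x}

omit [IsManifold (𝓡 n) ∞ M] in
theorem graph_eq_scale {p : TM n M} {k : ∀ x : M, TangentSpace (𝓡 n) x} {t : ℝ}
    (h : k p.proj = t • p.snd) : graph k p.proj = scale t p := by
  change (⟨p.proj, k p.proj⟩ : TM n M) = ⟨p.proj, t • p.snd⟩
  rw [h]

theorem IsRepresentative.exists_smul_snd (hk : IsRepresentative s W k) {p : TM n M}
    (hp : p.proj ∈ W) (h : ∃ h0 : p.snd ≠ 0, ray ⟨p, h0⟩ = s p.proj) :
    ∃ t : ℝ, 0 < t ∧ k p.proj = t • p.snd := by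
  obtain ⟨h0, hr⟩ := h
  obtain ⟨h1, h2⟩ := hk.spans _ hp
  obtain ⟨t, ht, e⟩ := exists_smul_of_ray_eq (hr.trans h2.symm)
  exact ⟨t, ht, (TotalSpace.mk_inj.1
    (e : (⟨p.proj, t • p.snd⟩ : TM n M) = ⟨p.proj, k p.proj⟩)).symm⟩

theorem tanChart_graph_mem_region (L : DefiningFunction 𝒢) {x : M}
    (h : graph k x ∈ L.domain) : tanChart n x (graph k x) ∈ L.region x := by
  have h1 := L.coord_mem_region h
  rwa [coord_graph, ← tanChart_graph' (mem_extChartAt_source x)] at h1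

/-- The normalized divergence along a curve of the congruence. -/
theorem exists_normalized_expansion (hn : 1 ≤ n) (L : DefiningFunction 𝒢)
    (h𝒮 : IsSachsManifold 𝒢 𝒮) (hs : IsSmoothSection 𝒮 N s) {p : TM n M} (hpd : p ∈ L.domain)
    (hpN : p.proj ∈ N) (hps : ∃ h0 : p.snd ≠ 0, ray ⟨p, h0⟩ = s p.proj) :
    ∃ θ : ℝ, ∀ (W : Set M) (k : ∀ x : M, TangentSpace (𝓡 n) x) (y : M) (μ : ℝ),
      IsRepresentative s W k → p.proj ∈ W → p.proj ∈ (baseChart n y).source → 0 < μ →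
      k p.proj = μ • p.snd → tanChart n y (graph k p.proj) ∈ L.region y →
      HasExpansion (L.localFn y) (fieldRep k y) (baseChart n y p.proj) (μ * θ) := by
  obtain ⟨W₀, k₀, hx₀, hk₀⟩ := hs.smooth _ hpN
  obtain ⟨t₀, ht₀, hkt₀⟩ := hk₀.exists_smul_snd hx₀ hps
  have hd₀ : graph k₀ p.proj ∈ L.domain := by
    rw [graph_eq_scale hkt₀]; exact L.scale_mem p hpd t₀ ht₀
  obtain ⟨b, hb⟩ := exists_hasExpansion hn L h𝒮 hs hk₀ hx₀ hpN hd₀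
  -- Dividing by the scale of the auxiliary representative gives the expansion normalized to the
  -- vector `p` itself.
  refine ⟨b / t₀, fun W k y μ hk hxW hy hμ hkμ hreg => ?_⟩
  have h1 : k p.proj = (μ / t₀) • k₀ p.proj := by
    rw [hkμ, hkt₀, smul_smul, div_mul_cancel₀ _ ht₀.ne']
  have h2 := expansion_change L hk₀ hk hx₀ hxW (mem_extChartAt_source _) hy
    (tanChart_graph_mem_region L hd₀) hreg (div_pos hμ ht₀) h1 hb
  have e : μ * (b / t₀) = μ / t₀ * b := by ring
  rwa [e]

/-- The divergence is the expansion of an affinely parametrized field. -/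
theorem hasExpansion_divergence (L : DefiningFunction 𝒢) (hk : IsRepresentative s W k) {x : M}
    (hx : x ∈ W) (haff : pushforward k x (k x) = spray L.G (graph k x)) :
    HasExpansion (L.localFn x) (fieldRep k x) (baseChart n x x) (divergence L.G k x) := by
  have h1 : spray L.G (graph k x) =
      (localSpray (L.localFn x) (baseChart n x x, fieldRep k x (baseChart n x x)) :
        Eu n × Eu n) := by
    rw [← coord_graph]; rfl
  have h2 := (pushforward_apply hk hx (k x)).symm.trans (haff.trans h1)
  obtain ⟨e1, e2⟩ := Prod.mk.inj h2
  refine ⟨0, ?_, ?_⟩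
  · rw [← e2]
    rw [show (k x : Eu n) = fieldRep k x (baseChart n x x) from e1]
    simp
  · rw [add_zero, traceL_apply]
    unfold divergence
    have h3 : (sectionEnd L.G k x : Eu n →L[ℝ] Eu n) =
        fieldEnd (L.localFn x) (fieldRep k x) (baseChart n x x) := by
      ext1 X
      have e3 : sectionEnd L.G k x X = localConnection (L.localFn x) (coord (graph k x))
        (pushforward k x X : Eu n × Eu n) := rfl
      refine e3.trans ((congrArg (localConnection (L.localFn x) (coord (graph k x)))
        (pushforward_apply hk hx X)).trans ?_)
      rw [coord_graph, localConnection_apply]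
      rfl
    exact congrArg (fun A : Eu n →L[ℝ] Eu n => LinearMap.trace ℝ (Eu n) A.toLinearMap) h3

theorem hasDerivAt_tanChart {L : DefiningFunction 𝒢} {J : Set ℝ} {c : ℝ → TM n M}
    (hc : IsFutureCompleteNullGeodesic L J c) {t : ℝ} (ht : t ∈ J) :
    HasDerivAt (fun r => tanChart n (c t).proj (c r))
      (localSpray (L.localFn (c t).proj) (coord (c t))) t := by
  have h1 := (hc.isIntegralCurve t ht).hasMFDerivAt (hc.isOpen.mem_nhds ht)
  have h2 : HasFDerivWithinAt (fun r : ℝ => tanChart n (c t).proj (c r))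
    ((1 : ℝ →L[ℝ] ℝ).smulRight (localSpray (L.localFn (c t).proj) (coord (c t))))
    (range 𝓘(ℝ, ℝ)) t := h1.2
  rw [ModelWithCorners.range_eq_univ, hasFDerivWithinAt_univ] at h2
  have h4 := h2.hasDerivAt
  simpa using h4

/-- The Riccati inequality for the normalized divergence. -/
theorem riccati_of_sachs (hn : 1 ≤ n) (L : DefiningFunction 𝒢)
    (hLor : ∀ p ∈ L.domain, p ∈ cone 𝒢 → IsLorentzian (metricAt L.G p))
    {J : Set ℝ} {c : ℝ → TM n M} (hc : IsFutureCompleteNullGeodesic L J c)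
    (henergy : ∀ t ∈ J, tidalTrace L.G (c t) ≤ 0)
    (h𝒮 : IsSachsManifold 𝒢 𝒮) (hs : IsSmoothSection 𝒮 N s)
    (hcN : ∀ t ∈ J, (c t).proj ∈ N)
    (hcs : ∀ t ∈ J, ∃ h : (c t).snd ≠ 0, ray ⟨c t, h⟩ = s (c t).proj) {θ : ℝ → ℝ}
    (hθ : ∀ t ∈ J, ∀ (W : Set M) (k : ∀ x : M, TangentSpace (𝓡 n) x) (y : M) (μ : ℝ),
      IsRepresentative s W k → (c t).proj ∈ W → (c t).proj ∈ (baseChart n y).source → 0 < μ →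
      k (c t).proj = μ • (c t).snd → tanChart n y (graph k (c t).proj) ∈ L.region y →
      HasExpansion (L.localFn y) (fieldRep k y) (baseChart n y (c t).proj) (μ * θ t))
    {t₀ : ℝ} (ht₀ : t₀ ∈ J) :
    ∃ θ' : ℝ, HasDerivAt θ θ' t₀ ∧ θ t₀ ^ 2 ≤ n * (-θ') := by
  set x := (c t₀).proj with hx
  obtain ⟨W, k₁, hxW, hk₁⟩ := hs.smooth _ (hcN t₀ ht₀)
  obtain ⟨a, ha, hka⟩ := hk₁.exists_smul_snd hxW (hcs t₀ ht₀)
  -- A constant rescaling makes the field agree with the velocity of the geodesic at `t₀`, as the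
  -- coordinate inequality requires.
  set k : ∀ x : M, TangentSpace (𝓡 n) x := fun x => a⁻¹ • k₁ x with hkdef
  have hk : IsRepresentative s W k := hk₁.const_smul (inv_pos.mpr ha)
  have hkx : k x = (c t₀).snd := by
    rw [hkdef]; simp only
    rw [hka, smul_smul, inv_mul_cancel₀ ha.ne', one_smul]
  have hgx : graph k x = c t₀ := by
    change (⟨x, k x⟩ : TM n M) = c t₀
    rw [hkx]
  have hxs : x ∈ (baseChart n x).source := mem_extChartAt_source x
  have hgd : graph k x ∈ L.domain := by rw [hgx]; exact hc.mem_domain t₀ ht₀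
  have hxN : x ∈ N := hcN t₀ ht₀
  have hgc : graph k x ∈ cone 𝒮 := graph_mem_cone hs hk hxW hxN
  have hR := L.isRegularOn x
  set f := L.localFn x with hf
  set κ := fieldRep k x with hκ
  set ξ := baseChart n x x with hξ
  have hcoord : coord (graph k x) = (ξ, κ ξ) := coord_graph k x
  have hcoord' : coord (c t₀) = (ξ, κ ξ) := by rw [← hgx]; exact hcoord
  have hz : (ξ, κ ξ) ∈ L.region x := by rw [← hcoord]; exact L.coord_mem_region hgd
  have hκs : ContDiffAt ℝ ∞ κ ξ := hk.contDiffAt hxW hxs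
  have hκ0 : κ ξ ≠ 0 := fieldRep_ne_zero hxs (hk.ne_zero hxW)
  have hreg : ∀ᶠ ζ in 𝓝 ξ, (ζ, κ ζ) ∈ L.region x :=
    (hk.hasFDerivAt hxW).continuousAt.eventually_mem (hR.mem_nhds hz)
  have hWN : ∀ᶠ ζ in 𝓝 ξ, (baseChart n x).symm ζ ∈ W ∩ N :=
    eventually_symm_mem hxs (Filter.inter_mem (hk.isOpen.mem_nhds hxW) (hs.isOpen.mem_nhds hxN))
  have hγ := hasDerivAt_tanChart hc ht₀
  have hgood : ∀ᶠ t in 𝓝 t₀, t ∈ J ∧ (c t).proj ∈ W ∧ (c t).proj ∈ (baseChart n x).source := by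
    have h1 := (hc.isIntegralCurve t₀ ht₀).hasMFDerivAt (hc.isOpen.mem_nhds ht₀)
    have h2 : ContinuousAt (fun t => (c t).proj) t₀ :=
      (FiberBundle.continuous_proj (Eu n) (TangentSpace (𝓡 n) : M → Type _)).continuousAt.comp h1.1
    filter_upwards [hc.isOpen.mem_nhds ht₀, h2.eventually_mem (hk.isOpen.mem_nhds hxW),
      h2.eventually_mem ((isOpen_extChartAt_source (I := 𝓡 n) x).mem_nhds hxs)] with t h3 h4 h5
    exact ⟨h3, h4, h5⟩
  obtain ⟨μ, hμ⟩ : ∃ μ : ℝ → ℝ, ∀ᶠ t in 𝓝 t₀, 0 < μ t ∧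
      k (c t).proj = μ t • (c t).snd := by
    classical
    refine ⟨fun t => if h : ∃ r : ℝ, 0 < r ∧ k (c t).proj = r • (c t).snd then h.choose else 0, ?_⟩
    filter_upwards [hgood] with t ht
    have h := hk.exists_smul_snd ht.2.1 (hcs t ht.1)
    simp only [h, dif_pos]
    exact h.choose_spec
  have hcont : Filter.Tendsto (fun t => (tanChart n x (c t)).1) (𝓝 t₀) (𝓝 ξ) := by
    have := hγ.continuousAt.fst.tendsto
    have e : (tanChart n x (c t₀)).1 = ξ := congrArg Prod.fst hcoord'
    rw [← e]
    exact this
  have hfin : (Module.finrank ℝ (Eu n) : ℝ) = n := by simp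
  rw [← hfin]
  refine hR.riccati L.degree_ne_one (κ := κ) (x := ξ) (γ := fun t => tanChart n x (c t)) (μ := μ)
    hκs hz hκ0 ?_ ?_ ?_ ?_ ?_ ?_ ?_ hcoord' ?_ ?_
  · filter_upwards [hreg, hWN] with ζ h1 h2
    have h3 := (L.zero_iff _ h1.1.2).2
    apply h3
    rw [tanChart_symm_field (mem_tanChart_target.1 h1.1.1)]
    obtain ⟨h4, h5⟩ := graph_mem_cone hs hk h2.1 h2.2
    exact ⟨h4, h𝒮.subset h5⟩
  · rw [← hcoord']
    exact hLor (c t₀) (hc.mem_domain t₀ ht₀) (hc.mem_cone t₀ ht₀)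
  · rw [← hcoord']
    exact L.vertD_ne_zero (c t₀) (hc.mem_domain t₀ ht₀)
  · intro X Y Z
    have h1 := h𝒮.hypersurfaceOrthogonal L (graph k x) hgd hgc _ _ _
      (isTangentTo_pushforward hs hk hxW hxN X) (isTangentTo_pushforward hs hk hxW hxN Y)
      (isTangentTo_pushforward hs hk hxW hxN Z)
    rw [pushforward_apply hk hxW, pushforward_apply hk hxW, pushforward_apply hk hxW] at h1
    rw [← hcoord]
    exact h1
  · have h1 := henergy t₀ ht₀
    rw [traceL_apply, ← localTidalTrace_eq hR hz, ← hcoord']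
    exact h1
  · filter_upwards [hreg, hWN] with ζ h1 h2
    have hζ : ζ ∈ (baseChart n x).target := mem_tanChart_target.1 h1.1.1
    set y := (baseChart n x).symm ζ with hy
    have hgy : graph k y ∈ L.domain := by
      rw [hy, ← tanChart_symm_field hζ]; exact h1.1.2
    -- The expansion is first found in the chart centred at the nearby point `y`, then moved to the
    -- fixed chart at `x`.
    obtain ⟨b, hb⟩ := exists_hasExpansion hn L h𝒮 hs hk h2.1 h2.2 hgy
    have h3 := expansion_change L hk hk h2.1 h2.1 (mem_extChartAt_source y)
      ((baseChart n x).map_target hζ) (tanChart_graph_mem_region L hgy)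
      (by rw [hy, tanChart_graph hζ]; exact h1) one_pos (one_smul ℝ (k y)).symm hb
    rw [hy, (baseChart n x).right_inv hζ] at h3
    exact ⟨_, h3⟩
  · rw [← hcoord']; exact hγ
  · filter_upwards [hμ, hgood] with t h1 h2
    refine ⟨h1.1.ne', ?_⟩
    have h3 := tanChart_scale x (μ t) (c t)
    rw [← graph_eq_scale h1.2, tanChart_graph' h2.2.2] at h3
    exact congrArg Prod.snd h3
  · filter_upwards [hμ, hgood, hcont.eventually hreg] with t h1 h2 h3
    refine hθ t h2.1 W k x (μ t) hk h2.2.1 h2.2.2 h1.1 h1.2 ?_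
    rw [tanChart_graph' h2.2.2]
    exact h3

end Main

end Causal

end
theorem mainTheorem3 {n : ℕ} (hn : 2 ≤ n) {M : Type*} [TopologicalSpace M] [T2Space M]
    [ChartedSpace (Causal.Eu n) M] [IsManifold (𝓡 n) ∞ M]
    (𝒢 : Set (Causal.SM n M)) (h𝒢 : Causal.IsRegularCausalGeometry 𝒢)
    (L : Causal.DefiningFunction 𝒢)
    (hLor : ∀ p ∈ L.domain, p ∈ Causal.cone 𝒢 → Causal.IsLorentzian (Causal.metricAt L.G p))
    (J : Set ℝ) (c : ℝ → Causal.TM n M) (hc : Causal.IsFutureCompleteNullGeodesic L J c)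
    (henergy : ∀ t ∈ J, Causal.tidalTrace L.G (c t) ≤ 0)
    (𝒮 : Set (Causal.SM n M)) (h𝒮 : Causal.IsSachsManifold 𝒢 𝒮)
    (N : Set M) (s : M → Causal.SM n M) (hs : Causal.IsSmoothSection 𝒮 N s)
    (hcN : ∀ t ∈ J, (c t).proj ∈ N)
    (hcs : ∀ t ∈ J, ∃ h : (c t).snd ≠ 0, Causal.ray ⟨c t, h⟩ = s (c t).proj) :
    ∀ t ∈ J, ∀ (W : Set M) (k : ∀ x : M, TangentSpace (𝓡 n) x),
      (c t).proj ∈ W → Causal.IsRepresentative s W k →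
      Causal.pushforward k (c t).proj (k (c t).proj) =
        Causal.spray L.G (Causal.graph k (c t).proj) →
      0 ≤ Causal.divergence L.G k (c t).proj := by
  intro t ht W k hxW hk haff
  have hn1 : 1 ≤ n := by omega
  -- Stated for every real `t`, with the irrelevant value 0 off `J`, so that choice gives a total
  -- function whose derivative can be taken.
  have hex : ∀ t, ∃ θ : ℝ, t ∈ J → ∀ (W : Set M) (k : ∀ x : M, TangentSpace (𝓡 n) x) (y : M)
      (μ : ℝ), Causal.IsRepresentative s W k → (c t).proj ∈ W →
      (c t).proj ∈ (Causal.baseChart n y).source → 0 < μ → k (c t).proj = μ • (c t).snd →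
      Causal.tanChart n y (Causal.graph k (c t).proj) ∈ L.region y →
      Causal.HasExpansion (L.localFn y) (Causal.fieldRep k y) (Causal.baseChart n y (c t).proj)
        (μ * θ) := by
    intro t
    by_cases ht : t ∈ J
    · obtain ⟨θ, hθ⟩ := Causal.exists_normalized_expansion hn1 L h𝒮 hs (hc.mem_domain t ht)
        (hcN t ht) (hcs t ht)
      exact ⟨θ, fun _ => hθ⟩
    · exact ⟨0, fun h => absurd h ht⟩
  choose θ hθ using hex
  have hric : ∀ t, ∃ θ' : ℝ, t ∈ J → HasDerivAt θ θ' t ∧ θ t ^ 2 ≤ n * (-θ') := by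
    intro t
    by_cases ht : t ∈ J
    · obtain ⟨θ', h⟩ := Causal.riccati_of_sachs hn1 L hLor hc henergy h𝒮 hs hcN hcs hθ ht
      exact ⟨θ', fun _ => h⟩
    · exact ⟨0, fun h => absurd h ht⟩
  choose θ' hθ' using hric
  have hnonneg : 0 ≤ θ t := Causal.nonneg_of_riccati hc.isUpperSet (fun t ht => (hθ' t ht).1)
    (fun t ht => (hθ' t ht).2) (by exact_mod_cast (by omega : 0 < n)) ht
  obtain ⟨μ, hμ, hkμ⟩ := hk.exists_smul_snd hxW (hcs t ht)
  have hdom : Causal.graph k (c t).proj ∈ L.domain := by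
    rw [Causal.graph_eq_scale hkμ]
    exact L.scale_mem _ (hc.mem_domain t ht) μ hμ
  have h1 := hθ t ht W k (c t).proj μ hk hxW (mem_extChartAt_source _) hμ hkμ
    (Causal.tanChart_graph_mem_region L hdom)
  have h2 := Causal.hasExpansion_divergence L hk hxW haff
  -- The divergence for `k` is `μ θ t`, with `μ > 0` the ratio of `k` to the velocity of the
  -- geodesic.
  rw [h2.unique (Causal.fieldRep_ne_zero (mem_extChartAt_source _) (hk.ne_zero hxW)) h1]
  positivity
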